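/- **Setting.** Let $X$, $Y$, $\partial X$ be (real or complex) Banach spaces with a continuous embedding $Y\hookrightarrow X$, and assume the following. * $A:D(A)\to X$ is a linear operator whose domain $D(A)$ is a linear subspace of $Y$; $R:D(A)\to\partial X$ is linear and surjective. * $B_1,B_2:Y\to\partial X$ and $B_3,B_4:\partial X\to\partial X$ are bounded linear operators. * The operator $\binom{A}{R}:D(A)\subset Y\to X\times\partial X$ is closed. * The restriction $A_0:=A|_{\ker R}$, regarded as an operator on $X$, generates a strongly continuous cosine operator function $(C(t))_{t\in\mathbb R}$ on $X$ with associated phase space $Y\times X$; that is, $D(A_0)$ is the set of all $z\in X$ for which $A_0z=\lim_{t\to0}\frac{2}{t^2}(C(t)z-z)$ exists, $Y$ is the set of all $z\in X$ for which $C(\cdot)z$ is continuously differentiable, and the norm of $Y$ is equivalent to $\|z\|_X+\sup_{0\le t\le1}\|C'(t)z\|_X$. Put $L:=R+B_2|_{D(A)}:D(A)\to\partial X$. Consider the second order problem with acoustic boundary conditions $$(\mathrm{AIBVP}_2)\quad \begin{cases} \ddot u(t)=Au(t), & t\in\mathbb R,\\ \ddot x(t)=B_1u(t)+B_2\dot u(t)+B_3x(t)+B_4\dot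 x(t), & t\in\mathbb R,\\ \dot x(t)=Lu(t), & t\in\mathbb R,\\ u(0)=f,\ \dot u(0)=g,\quad x(0)=h,\ \dot x(0)=j, & \end{cases}$$ and, on $\mathbb X:=Y\times X\times\partial X$ and $\partial\mathbb X:=\partial X$, its first order reformulation $$(\mathbb{AIBVP})\quad \begin{cases} \dot{\mathbb u}(t)=\mathbb A\mathbb u(t), & t\in\mathbb R,\\ \dot{\mathbb x}(t)=\mathbb B\mathbb u(t)+\tilde{\mathbb B}\mathbb x(t), & t\in\mathbb R,\\ \mathbb x(t)=\mathbb R\mathbb u(t), & t\in\mathbb R,\\ \mathbb u(0)=\mathbb u_0,\quad \mathbb x(0)=\mathbb x_0, & \end{cases}$$ where $$\mathbb A=\begin{pmatrix}0&I_Y&0\\A&0&0\\L&0&0\end{pmatrix},\quad D(\mathbb A)=D(A)\times Y\times\partial X,\qquad \mathbb R=\begin{pmatrix}R&0&0\end{pmatrix},\quad D(\mathbb R)=D(\mathbb A),$$ $$\mathbb B=\begin{pmatrix}B_1+B_4B_2&0&B_3\end{pmatrix}\in\mathcal L(\mathbb X,\partial\mathbb X),\qquad \tilde{\mathbb B}=B_4\in\mathcal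 L(\partial\mathbb X).$$ Let $\mathcal A$ be the one-sided coupled operator matrix on $\mathbb X\times\partial\mathbb X$ given by $$\mathcal A=\begin{pmatrix}\mathbb A&0\\ \mathbb B&\tilde{\mathbb B}\end{pmatrix},\qquad D(\mathcal A)=\Big\{\tbinom{\mathbb u}{\mathbb x}\in D(\mathbb A)\times\partial\mathbb X:\ \mathbb R\mathbb u=\mathbb x\Big\}.$$ A *classical solution* of $(\mathbb{AIBVP})$ is a function $\mathbb u\in C^1(\mathbb R,\mathbb X)$ with values in $D(\mathbb A)$ and with $\mathbb x:=\mathbb R\mathbb u\in C^1(\mathbb R,\partial\mathbb X)$ that satisfies the problem pointwise. A *classical solution* of $(\mathrm{AIBVP}_2)$ is a function $u\in C^2(\mathbb R,X)\cap C^1(\mathbb R,Y)$ with values in $D(A)$ and with $Lu\in C^1(\mathbb R,\partial X)$ that, together with a function $x\in C^2(\mathbb R,\partial X)$ (necessarily $x(t)=h+\int_0^tLu(s)\,ds$), satisfies the problem pointwise. **Proposition.** Under these assumptions the following hold. 1. $(\mathbb{AIBVP})$ is well-posed: $\mathcal A$ is closed and densely defined; for all $\mathbb u_0\in D(\mathbb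 A)$ and $\mathbb x_0=\mathbb R\mathbb u_0$ there is exactly one classical solution; and for every $T>0$ there is a constant $K$ such that every classical solution satisfies $\|\mathbb u(t)\|+\|\mathbb R\mathbb u(t)\|\le K(\|\mathbb u_0\|+\|\mathbb x_0\|)$ for $|t|\le T$. 2. $(\mathrm{AIBVP}_2)$ is well-posed: the admissible initial data, i.e. the $(f,g,h,j)$ with $f\in D(A)$, $g\in Y$, $h\in\partial X$, $j=Lf$, are dense in $Y\times X\times\partial X\times\partial X$; for all such data there is exactly one classical solution; and for every $T>0$ there is a constant $K$ such that every classical solution satisfies $\|u(t)\|_Y+\|\dot u(t)\|_X+\|x(t)\|+\|\dot x(t)\|\le K(\|f\|_Y+\|g\|_X+\|h\|+\|j\|)$ for $|t|\le T$. 3. $\mathcal A$ generates a $C_0$-group on $\mathbb X\times\partial\mathbb X$. -/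

import Mathlib

open Set Filter Topology

noncomputable section

namespace AcousticBC

/-! ### Unbounded operators given by a parametrization of their domain -/

section Param

variable {𝕜 P E F : Type*} [RCLike 𝕜] [AddCommGroup P] [Module 𝕜 P]
  [AddCommGroup E] [Module 𝕜 E] [AddCommGroup F] [Module 𝕜 F]

/-- The linear operator from `E` to `F` with domain `range j` that maps `j p` to `a p`,
for an injective linear map `j`. -/
def paramOp (j : P →ₗ[𝕜] E) (hj : Function.Injective j) (a : P →ₗ[𝕜] F) : E →ₗ.[𝕜] F where
  domain := LinearMap.range j
  toFun := a ∘ₗ (LinearEquiv.ofInjective j hj).symm.toLinearMap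

theorem mem_graph_paramOp (j : P →ₗ[𝕜] E) (hj : Function.Injective j) (a : P →ₗ[𝕜] F)
    (z : E × F) : z ∈ (paramOp j hj a).graph ↔ ∃ p, (j p, a p) = z := by
  rw [LinearPMap.mem_graph_iff]
  constructor
  · rintro ⟨⟨y, p, rfl⟩, h1, h2⟩
    refine ⟨p, Prod.ext h1 ?_⟩
    rw [← h2]
    change a p = a ((LinearEquiv.ofInjective j hj).symm (LinearEquiv.ofInjective j hj p))
    rw [LinearEquiv.symm_apply_apply]
  · rintro ⟨p, rfl⟩
    refine ⟨⟨j p, p, rfl⟩, rfl, ?_⟩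
    change a ((LinearEquiv.ofInjective j hj).symm (LinearEquiv.ofInjective j hj p)) = a p
    rw [LinearEquiv.symm_apply_apply]

end Param

/-! ### Strongly continuous groups and cosine operator functions -/

section Generators

variable {𝕜 E V : Type*} [RCLike 𝕜]
  [NormedAddCommGroup E] [NormedSpace ℝ E] [NormedSpace 𝕜 E]
  [NormedAddCommGroup V] [NormedSpace 𝕜 V]

/-- `T` is a strongly continuous group (`C₀`-group) of bounded linear operators on `E`. -/
structure IsC0Group (T : ℝ → E →L[𝕜] E) : Prop where
  map_zero : T 0 = ContinuousLinearMap.id 𝕜 E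
  map_add : ∀ s t, T (s + t) = (T s).comp (T t)
  strongly_continuous : ∀ z, Continuous fun t => T t z

/-- `G` is the generator of a `C₀`-group `T`: one has `z ∈ D(G)` and `G z = w` if and only if
`w` is the limit of `(T t z - z) / t` as `t → 0`. -/
def GeneratesC0Group (G : E →ₗ.[𝕜] E) : Prop :=
  ∃ T : ℝ → E →L[𝕜] E, IsC0Group T ∧
    ∀ z w, (z, w) ∈ G.graph ↔ HasDerivAt (fun t => T t z) w 0

/-- `C` is a (strongly continuous) cosine operator function on `E`. -/
structure IsCosineFunction (C : ℝ → E →L[𝕜] E) : Prop where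
  map_zero : C 0 = ContinuousLinearMap.id 𝕜 E
  dAlembert : ∀ s t z, C (t + s) z + C (t - s) z = (2 : ℝ) • C t (C s z)
  strongly_continuous : ∀ z, Continuous fun t => C t z

/-- `G` is the generator of the cosine operator function `C`: one has `z ∈ D(G)` and `G z = w`
if and only if `w` is the limit of `(2 / t²) (C t z - z)` as `t → 0`. -/
def IsCosineGenerator (C : ℝ → E →L[𝕜] E) (G : E →ₗ.[𝕜] E) : Prop :=
  ∀ z w, (z, w) ∈ G.graph ↔
    Tendsto (fun t : ℝ => (2 / t ^ 2) • (C t z - z)) (𝓝[≠] 0) (𝓝 w)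

/-- `V × E` is the phase space associated with the cosine function `C` on `E`, where `V` is
embedded in `E` by `ι`: the space `V` consists of all `z` such that `C(·) z` is continuously
differentiable, and its norm is equivalent to `‖z‖ + sup_{0 ≤ t ≤ 1} ‖C'(t) z‖`. -/
def IsPhaseSpace (C : ℝ → E →L[𝕜] E) (ι : V →L[𝕜] E) : Prop :=
  (∀ z, z ∈ range ι ↔ ContDiff ℝ 1 fun t => C t z) ∧
  ∃ c K : ℝ, 0 < c ∧ ∀ v,
    c * ‖v‖ ≤ ‖ι v‖ + ⨆ t : Icc (0 : ℝ) 1, ‖deriv (fun s => C s (ι v)) t‖ ∧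
    ‖ι v‖ + ⨆ t : Icc (0 : ℝ) 1, ‖deriv (fun s => C s (ι v)) t‖ ≤ K * ‖v‖

end Generators

/-! ### First order abstract initial-boundary value problems -/

section FirstOrder

variable (𝕜 : Type*) [RCLike 𝕜]
  (E dE : Type*) [NormedAddCommGroup E] [NormedSpace 𝕜 E]
  [NormedAddCommGroup dE] [NormedSpace 𝕜 dE]

/-- The operators of a first order abstract initial-boundary value problem
`u' = 𝔸 u`, `x' = 𝔹 u + 𝔹' x`, `x = ℝ u` on the spaces `E` and `dE`. -/
structure FirstOrderProblem where
  op : E →ₗ.[𝕜] E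
  bdry : op.domain →ₗ[𝕜] dE
  feedback : E →L[𝕜] dE
  bdryOp : dE →L[𝕜] dE

variable {𝕜 E dE}

namespace FirstOrderProblem

variable (P : FirstOrderProblem 𝕜 E dE)

theorem graph_injective : Function.Injective (P.op.domain.subtype.prod P.bdry) :=
  fun _ _ h => Subtype.ext (congrArg Prod.fst h)

/-- The operator matrix `(𝔸 0; 𝔹 𝔹')` on `E × dE` with the (coupled) domain
`{(u, x) ∈ D(𝔸) × dE : ℝ u = x}`. -/
def matrix : (E × dE) →ₗ.[𝕜] (E × dE) :=
  paramOp (P.op.domain.subtype.prod P.bdry)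
    P.graph_injective
    (P.op.toFun.prod
      (P.feedback.toLinearMap ∘ₗ P.op.domain.subtype + P.bdryOp.toLinearMap ∘ₗ P.bdry))

variable [NormedSpace ℝ E] [NormedSpace ℝ dE]

/-- `u` is a classical solution on the whole time axis with initial data `u(0) = u₀`,
`x(0) = x₀`, where `x(t) = ℝ u(t)`. -/
structure IsClassicalSolution (u₀ : E) (x₀ : dE) (u : ℝ → E) : Prop where
  contDiff : ContDiff ℝ 1 u
  mem : ∀ t, u t ∈ P.op.domain
  contDiff_bdry : ContDiff ℝ 1 fun t => P.bdry ⟨u t, mem t⟩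
  deriv_eq : ∀ t, deriv u t = P.op ⟨u t, mem t⟩
  deriv_bdry_eq : ∀ t, deriv (fun s => P.bdry ⟨u s, mem s⟩) t =
    P.feedback (u t) + P.bdryOp (P.bdry ⟨u t, mem t⟩)
  initial : u 0 = u₀
  initial_bdry : P.bdry ⟨u 0, mem 0⟩ = x₀

/-- Well-posedness: the operator matrix is closed and densely defined, every admissible initial
datum has exactly one classical solution, and the solutions depend continuously on the initial
data, uniformly on compact time intervals. -/
structure WellPosed : Prop where
  closed : P.matrix.IsClosed
  dense : Dense (P.matrix.domain : Set (E × dE))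
  existsUnique : ∀ (u₀ : E) (hu₀ : u₀ ∈ P.op.domain) (x₀ : dE), P.bdry ⟨u₀, hu₀⟩ = x₀ →
    ∃! u : ℝ → E, P.IsClassicalSolution u₀ x₀ u
  continuous_dependence : ∀ T : ℝ, ∃ K : ℝ, ∀ (u₀ : E) (x₀ : dE) (u : ℝ → E)
    (hu : P.IsClassicalSolution u₀ x₀ u), ∀ t ∈ Icc (-T) T,
      ‖u t‖ + ‖P.bdry ⟨u t, hu.mem t⟩‖ ≤ K * (‖u₀‖ + ‖x₀‖)

end FirstOrderProblem

end FirstOrder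

/-! ### The abstract second order problem with acoustic boundary conditions -/

section SecondOrder

variable (𝕜 : Type*) [RCLike 𝕜]
  (Y X dX : Type*)
  [NormedAddCommGroup Y] [NormedSpace 𝕜 Y]
  [NormedAddCommGroup X] [NormedSpace 𝕜 X]
  [NormedAddCommGroup dX] [NormedSpace 𝕜 dX]

/-- The operators of the second order problem: the embedding `ι` of `Y` in `X`, the operator
`A : D(A) ⊆ Y → X`, the boundary operator `R : D(A) → dX`, and bounded operators `B₁, …, B₄`. -/
structure AcousticData where
  ι : Y →L[𝕜] X
  ι_injective : Function.Injective ι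
  A : Y →ₗ.[𝕜] X
  R : A.domain →ₗ[𝕜] dX
  B₁ : Y →L[𝕜] dX
  B₂ : Y →L[𝕜] dX
  B₃ : dX →L[𝕜] dX
  B₄ : dX →L[𝕜] dX

variable {𝕜 Y X dX}

namespace AcousticData

variable (S : AcousticData 𝕜 Y X dX)

/-- `L = R + B₂` on `D(A)`. -/
def L : S.A.domain →ₗ[𝕜] dX := S.R + S.B₂.toLinearMap ∘ₗ S.A.domain.subtype

/-- The operator `(A; R) : D(A) ⊆ Y → X × dX`. -/
def opAR : Y →ₗ.[𝕜] (X × dX) := ⟨S.A.domain, S.A.toFun.prod S.R⟩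

theorem inclKer_injective : Function.Injective
    (S.ι.toLinearMap ∘ₗ S.A.domain.subtype ∘ₗ (LinearMap.ker S.R).subtype) :=
  fun _ _ h => Subtype.ext (Subtype.ext (S.ι_injective h))

/-- The restriction `A₀` of `A` to `ker R`, as an operator on `X`. -/
def A₀ : X →ₗ.[𝕜] X :=
  paramOp (S.ι.toLinearMap ∘ₗ S.A.domain.subtype ∘ₗ (LinearMap.ker S.R).subtype)
    S.inclKer_injective
    (S.A.toFun ∘ₗ (LinearMap.ker S.R).subtype)

/-- The inclusion of `D(A) × Y × dX` in `Y × X × dX`. -/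
def incl : (S.A.domain × Y × dX) →ₗ[𝕜] (Y × X × dX) :=
  S.A.domain.subtype.prodMap (S.ι.toLinearMap.prodMap LinearMap.id)

theorem incl_injective : Function.Injective S.incl := by
  rintro ⟨u, v, x⟩ ⟨u', v', x'⟩ h
  obtain ⟨h1, h2, h3⟩ : (u : Y) = u' ∧ S.ι v = S.ι v' ∧ x = x' := by
    simpa [incl] using h
  rw [Subtype.ext h1, S.ι_injective h2, h3]

/-- The first order reformulation on `Y × X × dX` and `dX`:
`𝔸 = (0 I 0; A 0 0; L 0 0)` with domain `D(A) × Y × dX`, `ℝ = (R 0 0)` with the same domain,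
`𝔹 = (B₁ + B₄ B₂, 0, B₃)`, and `𝔹' = B₄`. -/
def firstOrder : FirstOrderProblem 𝕜 (Y × X × dX) dX where
  op := paramOp S.incl S.incl_injective
    ((LinearMap.fst 𝕜 Y dX ∘ₗ LinearMap.snd 𝕜 S.A.domain (Y × dX)).prod
      ((S.A.toFun ∘ₗ LinearMap.fst 𝕜 S.A.domain (Y × dX)).prod
        (S.L ∘ₗ LinearMap.fst 𝕜 S.A.domain (Y × dX))))
  bdry := S.R ∘ₗ LinearMap.fst 𝕜 S.A.domain (Y × dX) ∘ₗ
    (LinearEquiv.ofInjective S.incl S.incl_injective).symm.toLinearMap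
  feedback := (S.B₁ + S.B₄.comp S.B₂).comp (ContinuousLinearMap.fst 𝕜 Y (X × dX)) +
    S.B₃.comp ((ContinuousLinearMap.snd 𝕜 X dX).comp (ContinuousLinearMap.snd 𝕜 Y (X × dX)))
  bdryOp := S.B₄

variable [NormedSpace ℝ Y] [NormedSpace ℝ X] [NormedSpace ℝ dX]

/-- The standing assumptions on the operators. (Linearity, boundedness of `ι, B₁, …, B₄`, and
`D(A) ⊆ Y` are already part of the data.) -/
structure Assumptions : Prop where
  surjective : Function.Surjective S.R
  closed : S.opAR.IsClosed
  cosine : ∃ C : ℝ → X →L[𝕜] X,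
    IsCosineFunction C ∧ IsCosineGenerator C S.A₀ ∧ IsPhaseSpace C S.ι

/-- The pair `(u, x)` is a classical solution on `(Y, X, dX)` of
`u'' = A u`, `x'' = B₁ u + B₂ u' + B₃ x + B₄ x'`, `x' = L u` on the whole time axis, with
`u(0) = f`, `u'(0) = g`, `x(0) = h`, `x'(0) = j`. -/
structure IsClassicalSolution (f g : Y) (h j : dX) (u : ℝ → Y) (x : ℝ → dX) : Prop where
  contDiff_two : ContDiff ℝ 2 fun t => S.ι (u t)
  contDiff_one : ContDiff ℝ 1 u
  mem : ∀ t, u t ∈ S.A.domain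
  contDiff_L : ContDiff ℝ 1 fun t => S.L ⟨u t, mem t⟩
  contDiff_bdry : ContDiff ℝ 2 x
  interior : ∀ t, deriv (deriv fun s => S.ι (u s)) t = S.A ⟨u t, mem t⟩
  boundary : ∀ t, deriv (deriv x) t =
    S.B₁ (u t) + S.B₂ (deriv u t) + S.B₃ (x t) + S.B₄ (deriv x t)
  coupling : ∀ t, deriv x t = S.L ⟨u t, mem t⟩
  initial_u : u 0 = f
  initial_u' : deriv u 0 = g
  initial_x : x 0 = h
  initial_x' : deriv x 0 = j

/-- Well-posedness of the second order problem: the admissible initial data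
(`f ∈ D(A)`, `g ∈ Y`, `h, j ∈ dX`, `L f = j`) are dense in `Y × X × dX × dX`, each of them has
exactly one classical solution, and the solutions depend continuously on the initial data,
uniformly on compact time intervals. -/
structure WellPosed₂ : Prop where
  dense : Dense {z : Y × X × dX × dX | ∃ (f : S.A.domain) (g : Y) (h : dX),
    z = ((f : Y), S.ι g, h, S.L f)}
  existsUnique : ∀ (f : Y) (hf : f ∈ S.A.domain) (g : Y) (h j : dX), S.L ⟨f, hf⟩ = j →
    ∃! p : (ℝ → Y) × (ℝ → dX), S.IsClassicalSolution f g h j p.1 p.2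
  continuous_dependence : ∀ T : ℝ, ∃ K : ℝ, ∀ (f g : Y) (h j : dX) (u : ℝ → Y) (x : ℝ → dX),
    S.IsClassicalSolution f g h j u x → ∀ t ∈ Icc (-T) T,
      ‖u t‖ + ‖S.ι (deriv u t)‖ + ‖x t‖ + ‖deriv x t‖ ≤ K * (‖f‖ + ‖S.ι g‖ + ‖h‖ + ‖j‖)

end AcousticData

end SecondOrder

end AcousticBC

end

noncomputable section

set_option linter.unusedSectionVars false

namespace AcousticBC

/-! ### Strongly continuous families of operators -/

section StronglyContinuous

variable {𝕜 E F : Type*} [RCLike 𝕜]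
  [NormedAddCommGroup E] [NormedSpace ℝ E] [NormedSpace 𝕜 E] [IsScalarTower ℝ 𝕜 E]
  [NormedAddCommGroup F] [NormedSpace ℝ F] [NormedSpace 𝕜 F] [IsScalarTower ℝ 𝕜 F]

/-! Everything rests on the generation statement, and that is a similarity plus a bounded
perturbation. The cosine function `C` with sine function `S` gives the group `(C S; C' C)` on the
phase space `Y × X`, with generator `(0 I; A₀ 0)` (`IsCosineFunction.exists_phaseSpaceGroup`). A
large real `μ` lies in the resolvent set of this generator, so `c - A₀` is bijective for `c = μ²`.
As `R` is onto and `(A; R)` is closed, `A u = c u`, `R u = x` then has a unique solution `u = D x`,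
with `D : dX → Y` bounded (`Assumptions.exists_dirichlet`).

Substitute `w = u - D x`. The coupling `R u = x` becomes `w ∈ ker R`, which decouples the domain. In
the variables `((w, v), (y, x))` the system reads `w' = v - D x'`, `v' = A₀ w + c D x`, `y' = x + B₂
(w + D x)`, where `x'` is a bounded function of the state. Thus the matrix is similar to `(0 I; A₀
0) ⊕ 0` plus a bounded operator, and bounded perturbations preserve generation of a group
(`IsC0Group.exists_perturbation`).

Classical solutions of the first order problem are precisely the orbits starting in the domain of
the generator, which yields its well-posedness. The second order problem corresponds to it through
`(u, u', x)`, with boundary component `R u = x' - B₂ u`. -/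

theorem hasDerivAt_clm_apply (Φ : E →L[𝕜] F) {f : ℝ → E} {f' : E} {t : ℝ}
    (hf : HasDerivAt f f' t) : HasDerivAt (fun s => Φ (f s)) (Φ f') t :=
  (Φ.restrictScalars ℝ).hasFDerivAt.comp_hasDerivAt t hf

/-- Orbits are bounded on compact intervals, so the uniform boundedness principle applies. This
local bound replaces continuity in operator norm, which is not assumed. -/
theorem exists_norm_le_of_stronglyContinuous [CompleteSpace E] {T : ℝ → E →L[𝕜] F}
    (hT : ∀ z, Continuous fun t => T t z) (a : ℝ) :
    ∃ M, 0 ≤ M ∧ ∀ t ∈ Icc (-a) a, ‖T t‖ ≤ M := by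
  obtain ⟨M, hM⟩ := banach_steinhaus (g := fun t : Icc (-a) a => T t) (by
    intro z
    obtain ⟨c, hc⟩ := (isCompact_Icc (a := -a) (b := a)).exists_bound_of_continuousOn
      (hT z).continuousOn
    exact ⟨c, fun t => hc t t.2⟩)
  exact ⟨max M 0, le_max_right _ _, fun t ht => (hM ⟨t, ht⟩).trans (le_max_left _ _)⟩

theorem tendsto_apply_of_stronglyContinuous [CompleteSpace E] {T : ℝ → E →L[𝕜] F}
    (hT : ∀ z, Continuous fun t => T t z) {x : ℝ → E} {z : E} {t₀ : ℝ} {l : Filter ℝ}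
    (hl : l ≤ 𝓝 t₀) (hx : Tendsto x l (𝓝 z)) :
    Tendsto (fun t => T t (x t)) l (𝓝 (T t₀ z)) := by
  obtain ⟨M, hM0, hM⟩ := exists_norm_le_of_stronglyContinuous hT (|t₀| + 1)
  have h1 : Tendsto (fun t => T t (x t - z)) l (𝓝 0) := by
    have h2 : Tendsto (fun t => M * ‖x t - z‖) l (𝓝 0) := by
      have := (tendsto_iff_norm_sub_tendsto_zero.1 hx).const_mul M
      simpa using this
    refine squeeze_zero_norm' ?_ h2
    have h3 : ∀ᶠ t in l, t ∈ Icc (-(|t₀| + 1)) (|t₀| + 1) := by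
      refine hl (Icc_mem_nhds ?_ ?_)
      · linarith [neg_abs_le t₀]
      · linarith [le_abs_self t₀]
    filter_upwards [h3] with t ht
    exact (T t).le_of_opNorm_le (hM t ht) _
  have h4 : Tendsto (fun t => T t z) l (𝓝 (T t₀ z)) := ((hT z).tendsto t₀).mono_left hl
  have := h1.add h4
  simpa using this

theorem continuous_apply_of_stronglyContinuous [CompleteSpace E] {T : ℝ → E →L[𝕜] F}
    (hT : ∀ z, Continuous fun t => T t z) {x : ℝ → E} (hx : Continuous x) :
    Continuous fun t => T t (x t) :=
  continuous_iff_continuousAt.2 fun t =>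
    tendsto_apply_of_stronglyContinuous hT le_rfl (hx.tendsto t)

/-- No differentiability of `T` is needed: the difference quotient is `T t` applied to that of `x`,
and it converges by joint continuity of `(t, z) ↦ T t z`. -/
theorem hasDerivAt_apply_sub [CompleteSpace E] {T : ℝ → E →L[𝕜] F}
    (hT : ∀ z, Continuous fun t => T t z) {x : ℝ → E} {x' : E} {t₀ : ℝ}
    (hx : HasDerivAt x x' t₀) :
    HasDerivAt (fun t => T t (x t - x t₀)) (T t₀ x') t₀ := by
  rw [hasDerivAt_iff_tendsto_slope] at hx ⊢
  have := tendsto_apply_of_stronglyContinuous hT (t₀ := t₀) nhdsWithin_le_nhds hx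
  refine this.congr fun t => ?_
  simp only [slope_def_module, sub_self, map_zero, sub_zero]
  exact (T t).map_smul_of_tower _ _

/-- Product rule for a strongly continuous family applied to a curve. -/
theorem hasDerivAt_apply [CompleteSpace E] {T : ℝ → E →L[𝕜] F}
    (hT : ∀ z, Continuous fun t => T t z) {x : ℝ → E} {x' : E} {w : F} {t₀ : ℝ}
    (hx : HasDerivAt x x' t₀) (hw : HasDerivAt (fun t => T t (x t₀)) w t₀) :
    HasDerivAt (fun t => T t (x t)) (T t₀ x' + w) t₀ := by
  have := (hasDerivAt_apply_sub hT hx).add hw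
  refine this.congr_of_eventuallyEq (Eventually.of_forall fun t => ?_)
  simp

theorem hasDerivAt_integral {f : ℝ → E} [CompleteSpace E] (hf : Continuous f) (a t : ℝ) :
    HasDerivAt (fun u => ∫ s in a..u, f s) (f t) t :=
  (hf.integral_hasStrictDerivAt a t).hasDerivAt

theorem eq_of_hasDerivAt_zero {f : ℝ → E} (hf : ∀ t, HasDerivAt f 0 t) (s t : ℝ) : f s = f t :=
  is_const_of_deriv_eq_zero (fun t => (hf t).differentiableAt) (fun t => (hf t).deriv) s t

theorem eq_of_hasDerivAt_eq {f g f' : ℝ → E} (hf : ∀ t, HasDerivAt f (f' t) t)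
    (hg : ∀ t, HasDerivAt g (f' t) t) (h0 : f 0 = g 0) (t : ℝ) : f t = g t := by
  have := eq_of_hasDerivAt_zero (f := fun t => f t - g t)
    (fun t => by simpa using! (hf t).sub (hg t)) t 0
  simpa [h0, sub_eq_zero] using this

theorem norm_integral_apply_le [CompleteSpace E] {T : ℝ → E →L[𝕜] F} {M t : ℝ}
    (hM : ∀ s ∈ Icc (-|t|) |t|, ‖T s‖ ≤ M) (z : E) :
    ‖∫ s in (0)..t, T s z‖ ≤ M * |t| * ‖z‖ := by
  have := intervalIntegral.norm_integral_le_of_norm_le_const (a := 0) (b := t) (C := M * ‖z‖)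
    (f := fun s => T s z) (fun s hs => (T s).le_of_opNorm_le (hM s (by
      rcases le_total 0 t with h | h
      · rw [uIoc_of_le h] at hs
        rw [abs_of_nonneg h]
        exact ⟨by linarith [hs.1], hs.2⟩
      · rw [uIoc_of_ge h] at hs
        rw [abs_of_nonpos h]
        exact ⟨by linarith [hs.1], by linarith [hs.2]⟩)) z)
  calc _ ≤ _ := this
    _ = _ := by rw [sub_zero]; ring

theorem exists_integral_clm [CompleteSpace E] [CompleteSpace F] {T : ℝ → E →L[𝕜] F}
    (hT : ∀ z, Continuous fun t => T t z) (t : ℝ) :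
    ∃ Φ : E →L[𝕜] F, ∀ z, Φ z = ∫ s in (0)..t, T s z := by
  obtain ⟨M, -, hM⟩ := exists_norm_le_of_stronglyContinuous hT |t|
  refine ⟨LinearMap.mkContinuous
    { toFun := fun z => ∫ s in (0)..t, T s z
      map_add' := fun z w => ?_
      map_smul' := fun c z => ?_ } (M * |t|) fun z => norm_integral_apply_le hM z, fun z => rfl⟩
  · simp only [map_add]
    exact intervalIntegral.integral_add ((hT z).intervalIntegrable _ _)
      ((hT w).intervalIntegrable _ _)
  · simp

/-- The integral `∫₀ᵗ T(s) ds` of a strongly continuous family as a bounded operator. -/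
def integralCLM [CompleteSpace E] [CompleteSpace F] (T : ℝ → E →L[𝕜] F)
    (hT : ∀ z, Continuous fun t => T t z) (t : ℝ) : E →L[𝕜] F :=
  (exists_integral_clm hT t).choose

theorem integralCLM_apply [CompleteSpace E] [CompleteSpace F] {T : ℝ → E →L[𝕜] F}
    (hT : ∀ z, Continuous fun t => T t z) (t : ℝ) (z : E) :
    integralCLM T hT t z = ∫ s in (0)..t, T s z :=
  (exists_integral_clm hT t).choose_spec z

theorem integralCLM_zero [CompleteSpace E] [CompleteSpace F] {T : ℝ → E →L[𝕜] F}
    (hT : ∀ z, Continuous fun t => T t z) (z : E) : integralCLM T hT 0 z = 0 := by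
  simp [integralCLM_apply]

theorem hasDerivAt_integralCLM [CompleteSpace E] [CompleteSpace F] {T : ℝ → E →L[𝕜] F}
    (hT : ∀ z, Continuous fun t => T t z) (z : E) (t : ℝ) :
    HasDerivAt (fun t => integralCLM T hT t z) (T t z) t := by
  simp only [integralCLM_apply]
  exact hasDerivAt_integral (hT z) 0 t

theorem continuous_integralCLM [CompleteSpace E] [CompleteSpace F] {T : ℝ → E →L[𝕜] F}
    (hT : ∀ z, Continuous fun t => T t z) (z : E) : Continuous fun t => integralCLM T hT t z :=
  continuous_iff_continuousAt.2 fun t => (hasDerivAt_integralCLM hT z t).continuousAt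

end StronglyContinuous

/-! ### Strongly continuous groups -/

namespace IsC0Group

variable {𝕜 E : Type*} [RCLike 𝕜]
  [NormedAddCommGroup E] [NormedSpace ℝ E] [NormedSpace 𝕜 E] [IsScalarTower ℝ 𝕜 E]
  {T : ℝ → E →L[𝕜] E}

theorem apply_zero (hT : IsC0Group T) (z : E) : T 0 z = z := by rw [hT.map_zero]; rfl

theorem apply_add (hT : IsC0Group T) (s t : ℝ) (z : E) : T (s + t) z = T s (T t z) := by
  rw [hT.map_add]; rfl

theorem apply_apply_neg (hT : IsC0Group T) (t : ℝ) (z : E) : T t (T (-t) z) = z := by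
  rw [← hT.apply_add, add_neg_cancel, hT.apply_zero]

theorem hasDerivAt (hT : IsC0Group T) {z w : E} (h : HasDerivAt (fun t => T t z) w 0) (t : ℝ) :
    HasDerivAt (fun s => T s z) (T t w) t := by
  have h1 : HasDerivAt (fun s => T (s - t) z) w t := by
    have h' : HasDerivAt (fun s => T s z) w (t - t) := by simpa using h
    exact h'.comp_sub_const t t
  refine (hasDerivAt_clm_apply (T t) h1).congr_of_eventuallyEq (Eventually.of_forall fun s => ?_)
  simp only [← hT.apply_add, add_sub_cancel]

theorem hasDerivAt_apply_zero (hT : IsC0Group T) {z w : E}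
    (h : HasDerivAt (fun t => T t z) w 0) (t : ℝ) :
    HasDerivAt (fun s => T s (T t z)) (T t w) 0 := by
  have h1 : HasDerivAt (fun s => T s z) (T t w) (0 + t) := by simpa using hT.hasDerivAt h t
  simpa only [hT.apply_add] using h1.comp_add_const 0 t

variable [CompleteSpace E]

/-- The curve `r ↦ T (-r) (u r)` has derivative zero. This is the uniqueness principle for the
abstract Cauchy problem. -/
theorem eq_of_hasDerivAt (hT : IsC0Group T) {u u' : ℝ → E} (hu : ∀ t, HasDerivAt u (u' t) t)
    (hgen : ∀ t, HasDerivAt (fun s => T s (u t)) (u' t) 0) (t : ℝ) : u t = T t (u 0) := by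
  have h1 : ∀ s, HasDerivAt (fun r => T (-r) (u r)) 0 s := by
    intro s
    have h2 : HasDerivAt (fun r => T (-r) (u s)) (-(T (-s) (u' s))) s := by
      have := (hT.hasDerivAt (hgen s) (-s)).scomp s (hasDerivAt_neg s)
      simpa using! this
    have h3 := hasDerivAt_apply (T := fun r => T (-r))
      (fun z => (hT.strongly_continuous z).comp continuous_neg) (hu s) h2
    simpa using h3
  have h4 := eq_of_hasDerivAt_zero h1 t 0
  simp only [neg_zero, hT.apply_zero] at h4
  rw [← h4, hT.apply_apply_neg]

/-- Applying `T t` shifts the interval of integration to `[t, a + t]`, so only the endpoints depend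
on `t`. Hence integrals of arbitrary orbits lie in the domain of the generator. -/
theorem hasDerivAt_integral_apply (hT : IsC0Group T) (z : E) (a : ℝ) :
    HasDerivAt (fun t => T t (∫ s in (0)..a, T s z)) (T a z - z) 0 := by
  have hc := hT.strongly_continuous z
  have h1 : ∀ t, T t (∫ s in (0)..a, T s z) =
      (∫ s in (0)..(a + t), T s z) - ∫ s in (0)..t, T s z := by
    intro t
    rw [← ContinuousLinearMap.intervalIntegral_comp_comm _ (hc.intervalIntegrable _ _)]
    have : ∀ s, T t (T s z) = T (s + t) z := fun s => by rw [add_comm, hT.apply_add]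
    simp only [this]
    rw [intervalIntegral.integral_comp_add_right (fun s => T s z), zero_add,
      intervalIntegral.integral_interval_sub_left (hc.intervalIntegrable _ _)
        (hc.intervalIntegrable _ _)]
  simp only [h1]
  have h2 : HasDerivAt (fun t => ∫ s in (0)..(a + t), T s z) (T a z) 0 := by
    have h3 : HasDerivAt (fun t => ∫ s in (0)..t, T s z) (T a z) (a + 0) := by
      simpa using hasDerivAt_integral hc 0 a
    exact h3.comp_const_add a 0
  have h3 := hasDerivAt_integral hc 0 0
  rw [hT.apply_zero] at h3
  exact h2.sub h3

theorem sub_eq_integral (hT : IsC0Group T) {z w : E} (h : HasDerivAt (fun t => T t z) w 0)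
    (t : ℝ) : T t z = z + ∫ s in (0)..t, T s w := by
  refine eq_of_hasDerivAt_eq (g := fun t => z + ∫ s in (0)..t, T s w) (hT.hasDerivAt h)
    (fun t => ?_) ?_ t
  · exact (hasDerivAt_integral (hT.strongly_continuous w) 0 t).const_add z
  · simp [hT.apply_zero]

/-- The generator of a group is closed. -/
theorem isClosed_generator (hT : IsC0Group T) :
    IsClosed {p : E × E | HasDerivAt (fun t => T t p.1) p.2 0} := by
  -- The integrated form of the equation involves only bounded operators, so each of these
  -- conditions is closed.
  have key : {p : E × E | HasDerivAt (fun t => T t p.1) p.2 0} =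
      ⋂ t : ℝ, {p : E × E | T t p.1 = p.1 + ∫ s in (0)..t, T s p.2} := by
    ext p
    simp only [mem_ofPred_eq, mem_iInter]
    refine ⟨fun h t => hT.sub_eq_integral h t, fun h => ?_⟩
    simp only [h]
    have := (hasDerivAt_integral (hT.strongly_continuous p.2) 0 0).const_add p.1
    rwa [hT.apply_zero] at this
  rw [key]
  refine isClosed_iInter fun t => ?_
  simp only [← integralCLM_apply hT.strongly_continuous]
  exact isClosed_eq ((T t).continuous.comp continuous_fst)
    (continuous_fst.add ((integralCLM T _ t).continuous.comp continuous_snd))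

/-- The domain of the generator of a group is dense. -/
theorem dense_generator (hT : IsC0Group T) :
    Dense {z : E | ∃ w, HasDerivAt (fun t => T t z) w 0} := by
  intro z
  have h1 := (hasDerivAt_iff_tendsto_slope.1
    (hasDerivAt_integral (hT.strongly_continuous z) 0 0))
  rw [hT.apply_zero] at h1
  -- The approximants are the averages `a⁻¹ ∫₀ᵃ T s z ds`.
  refine mem_closure_of_tendsto h1 (Eventually.of_forall fun a => ?_)
  simp only [slope_def_module, intervalIntegral.integral_same, sub_zero]
  refine ⟨(a⁻¹ : ℝ) • (T a z - z), ?_⟩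
  have := (hT.hasDerivAt_integral_apply z a).const_smul (a⁻¹ : ℝ)
  refine this.congr_of_eventuallyEq (Eventually.of_forall fun t => ?_)
  exact (T t).map_smul_of_tower _ _

/-- Large real numbers belong to the resolvent set of the generator of a group. -/
theorem exists_resolvent (hT : IsC0Group T) :
    ∃ μ : ℝ, 0 < μ ∧ (∀ f, ∃ z, HasDerivAt (fun t => T t z) (μ • z - f) 0) ∧
      ∀ z, HasDerivAt (fun t => T t z) (μ • z) 0 → z = 0 := by
  -- With this `μ` a Neumann series inverts `1 - e^{-μ} T 1`. Integration over `[0, 1]` then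
  -- replaces the Laplace transform, and no growth bound on the group is needed.
  obtain ⟨μ, hμ, hμT⟩ : ∃ μ : ℝ, 0 < μ ∧ Real.exp (-μ) * ‖T 1‖ < 1 := by
    have h1 : Tendsto (fun μ : ℝ => Real.exp (-μ) * ‖T 1‖) atTop (𝓝 0) := by
      have := (Real.tendsto_exp_neg_atTop_nhds_zero).mul_const ‖T 1‖
      simpa using this
    obtain ⟨μ, h⟩ :=
      ((eventually_gt_atTop (0 : ℝ)).and (h1.eventually (gt_mem_nhds one_pos))).exists
    exact ⟨μ, h.1, h.2⟩
  refine ⟨μ, hμ, fun f => ?_, fun z hz => ?_⟩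
  · have hnorm : ‖((Real.exp (-μ) : ℝ) : 𝕜) • T 1‖ < 1 := by
      rw [norm_smul, RCLike.norm_ofReal, abs_of_pos (Real.exp_pos _)]
      exact hμT
    obtain ⟨V, hV⟩ := isUnit_one_sub_of_norm_lt_one hnorm
    obtain ⟨g, hg⟩ : ∃ g, g - Real.exp (-μ) • T 1 g = f := by
      refine ⟨(↑V⁻¹ : E →L[𝕜] E) f, ?_⟩
      have h1 : ((V : E →L[𝕜] E) * (↑V⁻¹ : E →L[𝕜] E)) f = f := by rw [V.mul_inv]; rfl
      rw [hV] at h1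
      have h2 : ∀ x : E, Real.exp (-μ) • x = ((Real.exp (-μ) : ℝ) : 𝕜) • x := fun x =>
        (RCLike.real_smul_eq_coe_smul (K := 𝕜) _ x)
      rw [h2]
      simpa using h1
    have hcont : Continuous fun s : ℝ => Real.exp (-(μ * s)) • T s g :=
      (by fun_prop : Continuous fun s : ℝ => Real.exp (-(μ * s))).smul (hT.strongly_continuous g)
    -- The derivative of `t ↦ T t z` at `0` is `μ z + e^{-μ} T 1 g - g`, and `g` was chosen to make
    -- this `μ z - f`.
    set z := ∫ s in (0 : ℝ)..1, Real.exp (-(μ * s)) • T s g with hz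
    refine ⟨z, ?_⟩
    have h1 : ∀ t, T t z = Real.exp (μ * t) • ((∫ s in (0)..(1 + t), Real.exp (-(μ * s)) • T s g)
        - ∫ s in (0)..t, Real.exp (-(μ * s)) • T s g) := by
      intro t
      rw [hz, ← ContinuousLinearMap.intervalIntegral_comp_comm _ (hcont.intervalIntegrable _ _),
        intervalIntegral.integral_interval_sub_left (hcont.intervalIntegrable _ _)
        (hcont.intervalIntegrable _ _)]
      have h2 := intervalIntegral.integral_comp_add_right (a := 0) (b := 1)
        (fun s => Real.exp (-(μ * s)) • T s g) t
      rw [zero_add] at h2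
      rw [← h2, ← intervalIntegral.integral_smul]
      congr 1
      ext s
      rw [(T t).map_smul_of_tower, smul_smul, ← Real.exp_add, ← hT.apply_add, add_comm t s]
      congr 2
      ring
    simp only [h1]
    have h2 : HasDerivAt (fun t => ∫ s in (0)..(1 + t), Real.exp (-(μ * s)) • T s g)
        (Real.exp (-μ) • T 1 g) 0 := by
      have h3 : HasDerivAt (fun t => ∫ s in (0)..t, Real.exp (-(μ * s)) • T s g)
          (Real.exp (-μ) • T 1 g) (1 + 0) := by
        simpa using hasDerivAt_integral hcont 0 1
      exact h3.comp_const_add 1 0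
    have h3 := hasDerivAt_integral hcont 0 0
    have h4 : HasDerivAt (fun t : ℝ => Real.exp (μ * t)) μ 0 := by
      have := ((hasDerivAt_id (0 : ℝ)).const_mul μ).exp
      simpa using this
    have h5 := h4.smul (h2.sub h3)
    refine h5.congr_deriv ?_
    simp only [mul_zero, Real.exp_zero, one_smul, add_zero, intervalIntegral.integral_same,
      sub_zero, neg_zero, hT.apply_zero, Pi.sub_apply]
    rw [← hg]
    abel
  · have h1 := hT.eq_of_hasDerivAt (u := fun t => Real.exp (μ * t) • z)
      (u' := fun t => Real.exp (μ * t) • μ • z) (fun t => by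
        have := (((hasDerivAt_id t).const_mul μ).exp).smul_const z
        simpa [smul_smul] using this) (fun t => by
        have := hz.const_smul (Real.exp (μ * t))
        refine this.congr_of_eventuallyEq (Eventually.of_forall fun s => ?_)
        exact (T s).map_smul_of_tower _ _) 1
    rw [mul_one, mul_zero, Real.exp_zero, one_smul] at h1
    by_contra hne
    have h2 : ‖z‖ ≤ Real.exp (-μ) * ‖T 1‖ * ‖z‖ := by
      have h3 : z = Real.exp (-μ) • T 1 z := by
        rw [← h1, smul_smul, ← Real.exp_add, neg_add_cancel, Real.exp_zero, one_smul]
      calc ‖z‖ = ‖Real.exp (-μ) • T 1 z‖ := by rw [← h3]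
        _ = Real.exp (-μ) * ‖T 1 z‖ := by rw [norm_smul, Real.norm_of_nonneg (Real.exp_pos _).le]
        _ ≤ Real.exp (-μ) * (‖T 1‖ * ‖z‖) := by gcongr; exact (T 1).le_opNorm z
        _ = _ := by ring
    nlinarith [norm_pos_iff.2 hne]

end IsC0Group

/-! ### Linear evolution equations and bounded perturbations of groups -/

section Evolution

variable {𝕜 E : Type*} [RCLike 𝕜]
  [NormedAddCommGroup E] [NormedSpace ℝ E] [NormedSpace 𝕜 E] [IsScalarTower ℝ 𝕜 E]
  {b : ℝ → E →L[𝕜] E}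

theorem norm_le_exp_of_hasDerivAt_of_nonneg {a M : ℝ}
    (hM : ∀ t ∈ Icc (-a) a, ‖b t‖ ≤ M) {v : ℝ → E} (hv : ∀ t, HasDerivAt v (b t (v t)) t)
    {t : ℝ} (ht : t ∈ Icc 0 a) : ‖v t‖ ≤ Real.exp (M * t) * ‖v 0‖ := by
  have := norm_le_gronwallBound_of_norm_deriv_right_le (f := v) (f' := fun t => b t (v t))
    (δ := ‖v 0‖) (K := M) (ε := 0) (a := 0) (b := a)
    (fun s _ => (hv s).continuousAt.continuousWithinAt) (fun s _ => (hv s).hasDerivWithinAt)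
    le_rfl (fun s hs => by
      rw [add_zero]
      exact (b s).le_of_opNorm_le (hM s ⟨by linarith [hs.1, hs.2], hs.2.le⟩) _) t ht
  rwa [sub_zero, gronwallBound_ε0, mul_comm] at this

theorem norm_le_exp_of_hasDerivAt {a M : ℝ} (hM : ∀ t ∈ Icc (-a) a, ‖b t‖ ≤ M) {v : ℝ → E}
    (hv : ∀ t, HasDerivAt v (b t (v t)) t) {t : ℝ} (ht : t ∈ Icc (-a) a) :
    ‖v t‖ ≤ Real.exp (M * |t|) * ‖v 0‖ := by
  rcases le_total 0 t with h | h
  · rw [abs_of_nonneg h]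
    exact norm_le_exp_of_hasDerivAt_of_nonneg hM hv ⟨h, ht.2⟩
  · rw [abs_of_nonpos h]
    -- Time reversal: `s ↦ v (-s)` solves the equation with coefficient `-b (-s)`.
    have h1 := norm_le_exp_of_hasDerivAt_of_nonneg (b := fun s => -b (-s)) (a := a) (M := M)
      (v := fun s => v (-s)) (fun s hs => by
        rw [norm_neg]
        exact hM _ ⟨by linarith [hs.2], by linarith [hs.1]⟩)
      (fun s => by
        have := (hv (-s)).scomp s (hasDerivAt_neg s)
        simpa using! this) (t := -t) ⟨by linarith, by linarith [ht.1]⟩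
    simpa using h1

/-- The summands of the Dyson series of `v' = b(t) v`, `v(0) = z`. -/
def dysonTerm (b : ℝ → E →L[𝕜] E) (z : E) : ℕ → ℝ → E
  | 0 => fun _ => z
  | n + 1 => fun t => ∫ s in (0)..t, b s (dysonTerm b z n s)

variable [CompleteSpace E]

theorem continuous_dysonTerm (hb : ∀ z, Continuous fun t => b t z) (z : E) (n : ℕ) :
    Continuous (dysonTerm b z n) := by
  induction n with
  | zero => exact continuous_const
  | succ n ih =>
    exact continuous_iff_continuousAt.2 fun t =>
      (hasDerivAt_integral (continuous_apply_of_stronglyContinuous hb ih) 0 t).continuousAt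

theorem hasDerivAt_dysonTerm_succ (hb : ∀ z, Continuous fun t => b t z) (z : E) (n : ℕ) (t : ℝ) :
    HasDerivAt (dysonTerm b z (n + 1)) (b t (dysonTerm b z n t)) t :=
  hasDerivAt_integral
    (continuous_apply_of_stronglyContinuous hb (continuous_dysonTerm hb z n)) 0 t

/-- The bound of order `n + 1` has derivative `M` times the bound of order `n`, so comparing
derivatives carries the induction. -/
theorem norm_dysonTerm_le_of_nonneg (hb : ∀ z, Continuous fun t => b t z) (z : E) {a M : ℝ}
    (hM0 : 0 ≤ M) (hM : ∀ t ∈ Icc (-a) a, ‖b t‖ ≤ M) (n : ℕ) :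
    ∀ t ∈ Icc 0 a, ‖dysonTerm b z n t‖ ≤ ‖z‖ * ((M * t) ^ n / n.factorial) := by
  induction n with
  | zero => intro t _; simp [dysonTerm]
  | succ n ih =>
    intro t ht
    refine image_norm_le_of_norm_deriv_right_le_deriv_boundary
      (f := dysonTerm b z (n + 1)) (f' := fun t => b t (dysonTerm b z n t)) (a := 0) (b := a)
      (B := fun t => ‖z‖ * ((M * t) ^ (n + 1) / (n + 1).factorial))
      (B' := fun t => M * (‖z‖ * ((M * t) ^ n / n.factorial)))
      (continuous_dysonTerm hb z (n + 1)).continuousOn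
      (fun s _ => (hasDerivAt_dysonTerm_succ hb z n s).hasDerivWithinAt) ?_ ?_ ?_ ht
    · simp [dysonTerm]
    · intro s
      have h1 := (((hasDerivAt_id s).const_mul M).pow (n + 1)).div_const ((n + 1).factorial : ℝ)
      refine (h1.const_mul ‖z‖).congr_deriv ?_
      rw [Nat.factorial_succ]
      push_cast
      simp only [id, mul_one]
      field_simp
    · intro s hs
      refine ((b s).le_of_opNorm_le (hM s ⟨by linarith [hs.1, hs.2], hs.2.le⟩) _).trans ?_
      exact mul_le_mul_of_nonneg_left (ih s ⟨hs.1, hs.2.le⟩) hM0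

theorem dysonTerm_neg (b : ℝ → E →L[𝕜] E) (z : E) (n : ℕ) (t : ℝ) :
    dysonTerm (fun s => -b (-s)) z n t = dysonTerm b z n (-t) := by
  induction n generalizing t with
  | zero => rfl
  | succ n ih =>
    simp only [dysonTerm, ih]
    have := intervalIntegral.integral_comp_neg (a := 0) (b := t)
      (fun s => b s (dysonTerm b z n s))
    rw [neg_zero] at this
    rw [intervalIntegral.integral_symm (-t) 0, ← this, ← intervalIntegral.integral_neg]
    rfl

theorem norm_dysonTerm_le (hb : ∀ z, Continuous fun t => b t z) (z : E) {a M : ℝ}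
    (hM0 : 0 ≤ M) (hM : ∀ t ∈ Icc (-a) a, ‖b t‖ ≤ M) (n : ℕ) {t : ℝ} (ht : t ∈ Icc (-a) a) :
    ‖dysonTerm b z n t‖ ≤ ‖z‖ * ((M * a) ^ n / n.factorial) := by
  have key : ∀ t' ∈ Icc 0 a, ‖z‖ * ((M * t') ^ n / n.factorial) ≤
      ‖z‖ * ((M * a) ^ n / n.factorial) := by
    intro t' h
    have := h.1
    have := h.2
    gcongr
  rcases le_total 0 t with h | h
  · exact (norm_dysonTerm_le_of_nonneg hb z hM0 hM n t ⟨h, ht.2⟩).trans (key t ⟨h, ht.2⟩)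
  · have h2 : -t ∈ Icc 0 a := ⟨by linarith, by linarith [ht.1]⟩
    have h1 := norm_dysonTerm_le_of_nonneg (b := fun s => -b (-s)) (a := a) (M := M)
      (fun z => ((hb z).comp continuous_neg).neg) z hM0 (fun s hs => by
        rw [norm_neg]
        exact hM _ ⟨by linarith [hs.2], by linarith [hs.1]⟩) n (-t) h2
    rw [dysonTerm_neg, neg_neg] at h1
    exact h1.trans (key _ h2)

/-- Existence of solutions of `v' = b(t) v` for a strongly continuous family `b`. -/
theorem exists_hasDerivAt_evolution (hb : ∀ z, Continuous fun t => b t z) (z : E) :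
    ∃ v : ℝ → E, v 0 = z ∧ ∀ t, HasDerivAt v (b t (v t)) t := by
  have hsum0 : ∀ a : ℝ, ∃ M, 0 ≤ M ∧ (∀ t ∈ Icc (-a) a, ‖b t‖ ≤ M) ∧
      Summable fun n : ℕ => ‖z‖ * ((M * a) ^ n / n.factorial) := fun a => by
    obtain ⟨M, hM0, hM⟩ := exists_norm_le_of_stronglyContinuous hb a
    exact ⟨M, hM0, hM, (Real.summable_pow_div_factorial (M * a)).mul_left _⟩
  have hsum : ∀ t, Summable fun n => dysonTerm b z n t := by
    intro t
    obtain ⟨M, hM0, hM, hs⟩ := hsum0 |t|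
    exact Summable.of_norm_bounded hs fun n =>
      norm_dysonTerm_le hb z hM0 hM n ⟨neg_abs_le t, le_abs_self t⟩
  refine ⟨fun t => ∑' n, dysonTerm b z n t, ?_, fun t => ?_⟩
  · change ∑' n, dysonTerm b z n 0 = z
    rw [tsum_eq_single 0]
    · rfl
    · intro n hn
      obtain ⟨m, rfl⟩ := Nat.exists_eq_succ_of_ne_zero hn
      simp [dysonTerm]
  · obtain ⟨M, hM0, hM, hs⟩ := hsum0 (|t| + 1)
    have hmem : t ∈ Ioo (-(|t| + 1)) (|t| + 1) :=
      ⟨by linarith [neg_abs_le t], by linarith [le_abs_self t]⟩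
    -- Only the tail from index `1` is differentiated; its derivatives add up to `b t` applied to
    -- the full series. An exponential series dominates them on the interval.
    have h1 := hasDerivAt_tsum_of_isPreconnected (g := fun n => dysonTerm b z (n + 1))
      (g' := fun n s => b s (dysonTerm b z n s)) (hs.mul_left M) isOpen_Ioo isPreconnected_Ioo
      (fun n s _ => hasDerivAt_dysonTerm_succ hb z n s)
      (fun n s h => by
        have h' : s ∈ Icc (-(|t| + 1)) (|t| + 1) := Ioo_subset_Icc_self h
        exact ((b s).le_of_opNorm_le (hM s h') _).trans
          (mul_le_mul_of_nonneg_left (norm_dysonTerm_le hb z hM0 hM n h') hM0)) hmem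
      ((summable_nat_add_iff 1).2 (hsum t)) hmem
    have h2 : ∑' n, b t (dysonTerm b z n t) = b t (∑' n, dysonTerm b z n t) :=
      ((b t).map_tsum (hsum t)).symm
    rw [h2] at h1
    refine (h1.const_add z).congr_of_eventuallyEq (Eventually.of_forall fun s => ?_)
    simp only [(hsum s).tsum_eq_zero_add]
    rfl

theorem eq_of_hasDerivAt_evolution (hb : ∀ z, Continuous fun t => b t z) {v w : ℝ → E}
    (hv : ∀ t, HasDerivAt v (b t (v t)) t) (hw : ∀ t, HasDerivAt w (b t (w t)) t)
    (h0 : v 0 = w 0) (t : ℝ) : v t = w t := by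
  obtain ⟨M, -, hM⟩ := exists_norm_le_of_stronglyContinuous hb |t|
  have := norm_le_exp_of_hasDerivAt (v := fun s => v s - w s) hM
    (fun s => by simpa using! (hv s).sub (hw s)) (t := t) ⟨neg_abs_le t, le_abs_self t⟩
  simpa [h0, sub_eq_zero] using this

/-- The evolution operators of `v' = b(t) v`. -/
theorem exists_evolution (hb : ∀ z, Continuous fun t => b t z) :
    ∃ W : ℝ → E →L[𝕜] E, (∀ z, W 0 z = z) ∧
      ∀ z t, HasDerivAt (fun s => W s z) (b t (W t z)) t := by
  choose v hv0 hv using exists_hasDerivAt_evolution hb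
  have hadd : ∀ z w t, v (z + w) t = v z t + v w t := fun z w t =>
    eq_of_hasDerivAt_evolution hb (hv (z + w)) (w := fun t => v z t + v w t)
      (fun t => by simpa using! (hv z t).add (hv w t)) (by simp [hv0]) t
  have hsmul : ∀ (c : 𝕜) z t, v (c • z) t = c • v z t := fun c z t =>
    eq_of_hasDerivAt_evolution hb (hv (c • z)) (w := fun t => c • v z t)
      (fun t => by
        simpa using hasDerivAt_clm_apply (c • ContinuousLinearMap.id 𝕜 E) (hv z t))
      (by simp [hv0]) t
  choose M _ hM using exists_norm_le_of_stronglyContinuous hb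
  refine ⟨fun t => LinearMap.mkContinuous
    { toFun := fun z => v z t
      map_add' := fun z w => hadd z w t
      map_smul' := fun c z => hsmul c z t }
    (Real.exp (M |t| * |t|)) fun z => ?_, fun z => hv0 z, fun z t => hv z t⟩
  have := norm_le_exp_of_hasDerivAt (hM |t|) (hv z) (t := t) ⟨neg_abs_le t, le_abs_self t⟩
  rwa [hv0] at this

/-- Bounded perturbations of generators of groups generate groups. -/
theorem IsC0Group.exists_perturbation {U : ℝ → E →L[𝕜] E} (hU : IsC0Group U) (B : E →L[𝕜] E) :
    ∃ T : ℝ → E →L[𝕜] E, IsC0Group T ∧ ∀ z w,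
      HasDerivAt (fun t => T t z) w 0 ↔ HasDerivAt (fun t => U t z) (w - B z) 0 := by
  -- Interaction picture: the perturbed group is sought as `U t W t`, which forces `W' = U (-t) B U
  -- (t) W`.
  have hb : ∀ z, Continuous fun t => ((U (-t)).comp (B.comp (U t))) z := fun z =>
    continuous_apply_of_stronglyContinuous (T := fun t => U (-t))
      (fun z => (hU.strongly_continuous z).comp continuous_neg)
      (B.continuous.comp (hU.strongly_continuous z))
  obtain ⟨W, hW0, hW⟩ := exists_evolution hb
  -- Since `U t W t z = U t z + U t (W t z - z)`, this derivative, valid for every `z`, shows that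
  -- the domain is unchanged and that the generators differ by `B`.
  have hgen : ∀ z, HasDerivAt (fun t => U t (W t z - z)) (B z) 0 := by
    intro z
    have := hasDerivAt_apply_sub hU.strongly_continuous (hW z 0)
    simpa [hW0, hU.apply_zero] using this
  refine ⟨fun t => (U t).comp (W t), ⟨?_, ?_, ?_⟩, fun z w => ⟨fun h => ?_, fun h => ?_⟩⟩
  · ext z
    simp [hW0, hU.apply_zero]
  · intro s t
    ext z
    -- Both sides solve the same evolution equation in `r` with the same value at `r = 0`.
    have h1 := eq_of_hasDerivAt_evolution hb (v := fun r => U t (W (r + t) z))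
      (w := fun r => W r (U t (W t z))) (fun r => by
        have := hasDerivAt_clm_apply (U t) ((hW z (r + t)).comp_add_const r t)
        refine this.congr_deriv ?_
        simp only [ContinuousLinearMap.comp_apply, ← hU.apply_add]
        rw [show t + -(r + t) = -r by ring])
      (fun r => hW _ r) (by simp [hW0]) s
    simp only [ContinuousLinearMap.comp_apply]
    rw [← h1, hU.apply_add]
  · exact fun z => continuous_apply_of_stronglyContinuous hU.strongly_continuous
      (continuous_iff_continuousAt.2 fun t => (hW z t).continuousAt)
  · refine (h.sub (hgen z)).congr_of_eventuallyEq (Eventually.of_forall fun t => ?_)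
    simp
  · have := h.add (hgen z)
    rw [sub_add_cancel] at this
    refine this.congr_of_eventuallyEq (Eventually.of_forall fun t => ?_)
    simp

end Evolution

/-! ### Cosine functions and their phase space groups -/

section Cosine

variable {𝕜 X Y : Type*} [RCLike 𝕜]
  [NormedAddCommGroup X] [NormedSpace ℝ X] [NormedSpace 𝕜 X] [IsScalarTower ℝ 𝕜 X]
  [NormedAddCommGroup Y] [NormedSpace ℝ Y] [NormedSpace 𝕜 Y] [IsScalarTower ℝ 𝕜 Y]

/-- Second order Taylor formula with Peano remainder. As `ψ` is differentiable only at `0`, the mean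
value inequality is applied to `φ s - (s² / 2) a`, whose derivative is `o(s)`. -/
theorem tendsto_two_div_sq_smul {φ ψ : ℝ → X} {a : X} (hφ : ∀ t, HasDerivAt φ (ψ t) t)
    (hφ0 : φ 0 = 0) (hψ0 : ψ 0 = 0) (hψ : HasDerivAt ψ a 0) :
    Tendsto (fun t : ℝ => (2 / t ^ 2) • φ t) (𝓝[≠] 0) (𝓝 a) := by
  rw [Metric.tendsto_nhdsWithin_nhds]
  intro ε hε
  have h1 := hψ.isLittleO.def (c := ε / 4) (by positivity)
  simp only [hψ0, sub_zero] at h1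
  obtain ⟨δ, hδ, h2⟩ := Metric.eventually_nhds_iff.1 h1
  refine ⟨δ, hδ, fun {t} ht htδ => ?_⟩
  have ht0 : t ≠ 0 := ht
  have h3 : ‖(φ t - (t ^ 2 / 2) • a) - (φ 0 - ((0 : ℝ) ^ 2 / 2) • a)‖ ≤
      (ε / 4 * |t|) * ‖t - 0‖ := by
    refine Convex.norm_image_sub_le_of_norm_hasDerivWithin_le
      (f := fun s => φ s - (s ^ 2 / 2) • a) (f' := fun s => ψ s - s • a) (s := uIcc 0 t) ?_ ?_
      (convex_uIcc 0 t) left_mem_uIcc right_mem_uIcc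
    · intro s _
      have h4 : HasDerivAt (fun s : ℝ => s ^ 2 / 2) s s := by
        refine ((hasDerivAt_pow 2 s).div_const 2).congr_deriv ?_
        simp
      exact ((hφ s).sub (h4.smul_const a)).hasDerivWithinAt
    · intro s hs
      have hs' : |s| ≤ |t| := by
        rcases le_total 0 t with h | h
        · rw [uIcc_of_le h] at hs
          rw [abs_of_nonneg h, abs_of_nonneg hs.1]
          exact hs.2
        · rw [uIcc_of_ge h] at hs
          rw [abs_of_nonpos h, abs_of_nonpos hs.2]
          linarith [hs.1]
      have := h2 (y := s) (by
        rw [dist_zero_right, Real.norm_eq_abs] at htδ ⊢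
        exact hs'.trans_lt htδ)
      rw [Real.norm_eq_abs] at this
      exact this.trans (by gcongr)
  simp only [hφ0, sub_zero, Real.norm_eq_abs] at h3
  have h5 : (2 / t ^ 2) • φ t - a = (2 / t ^ 2) • (φ t - (t ^ 2 / 2) • a) := by
    rw [smul_sub, smul_smul, div_mul_div_cancel₀ (by positivity), div_self two_ne_zero, one_smul]
  rw [dist_eq_norm, h5, norm_smul, Real.norm_of_nonneg (by positivity)]
  have h6 : ‖φ t - (t ^ 2 / 2) • a‖ ≤ ε / 4 * t ^ 2 := by
    rw [← sq_abs t]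
    calc _ ≤ _ := by simpa using h3
      _ = _ := by ring
  calc 2 / t ^ 2 * ‖φ t - (t ^ 2 / 2) • a‖ ≤ 2 / t ^ 2 * (ε / 4 * t ^ 2) := by gcongr
    _ = ε / 2 := by field_simp; norm_num
    _ < ε := by linarith

namespace IsCosineFunction

variable {C : ℝ → X →L[𝕜] X}

theorem apply_zero (hC : IsCosineFunction C) (z : X) : C 0 z = z := by rw [hC.map_zero]; rfl

theorem apply_neg (hC : IsCosineFunction C) (t : ℝ) (z : X) : C (-t) z = C t z := by
  have := hC.dAlembert t 0 z
  rw [hC.apply_zero, zero_add, zero_sub, two_smul] at this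
  exact add_left_cancel this

theorem apply_sub_comm (hC : IsCosineFunction C) (s t : ℝ) (z : X) : C (s - t) z = C (t - s) z := by
  rw [← hC.apply_neg, neg_sub]

theorem apply_apply (hC : IsCosineFunction C) (s t : ℝ) (z : X) :
    C t (C s z) = (1 / 2 : ℝ) • (C (t + s) z + C (t - s) z) := by
  rw [hC.dAlembert, smul_smul]
  norm_num

theorem apply_apply' (hC : IsCosineFunction C) (s t : ℝ) (z : X) :
    C t (C s z) = (1 / 2 : ℝ) • (C (s + t) z + C (s - t) z) := by
  rw [hC.apply_apply, hC.apply_sub_comm t s, add_comm t s]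

theorem apply_comm (hC : IsCosineFunction C) (s t : ℝ) (z : X) :
    C t (C s z) = C s (C t z) := by
  rw [hC.apply_apply, hC.apply_apply']

variable [CompleteSpace X]

/-- The sine function `S(t) = ∫₀ᵗ C(s) ds` associated with a cosine function. -/
def sine (hC : IsCosineFunction C) : ℝ → X →L[𝕜] X := integralCLM C hC.strongly_continuous

theorem sine_zero (hC : IsCosineFunction C) (z : X) : hC.sine 0 z = 0 := integralCLM_zero _ z

theorem hasDerivAt_sine (hC : IsCosineFunction C) (z : X) (t : ℝ) :
    HasDerivAt (fun t => hC.sine t z) (C t z) t := hasDerivAt_integralCLM _ z t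

theorem continuous_sine (hC : IsCosineFunction C) (z : X) : Continuous fun t => hC.sine t z :=
  continuous_integralCLM _ z

/-- The integral of the sine function. -/
def sineIntegral (hC : IsCosineFunction C) : ℝ → X →L[𝕜] X := integralCLM hC.sine hC.continuous_sine

theorem sineIntegral_zero (hC : IsCosineFunction C) (z : X) : hC.sineIntegral 0 z = 0 :=
  integralCLM_zero _ z

theorem hasDerivAt_sineIntegral (hC : IsCosineFunction C) (z : X) (t : ℝ) :
    HasDerivAt (fun t => hC.sineIntegral t z) (hC.sine t z) t := hasDerivAt_integralCLM _ z t

theorem hasDerivAt_half_smul {f f₁ f₂ : ℝ → X} {a b : X} {t : ℝ}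
    (hf : ∀ s, f s = (1 / 2 : ℝ) • (f₁ s + f₂ s)) (h₁ : HasDerivAt f₁ a t)
    (h₂ : HasDerivAt f₂ b t) : HasDerivAt f ((1 / 2 : ℝ) • (a + b)) t :=
  ((h₁.add h₂).const_smul (1 / 2 : ℝ)).congr_of_eventuallyEq (Eventually.of_forall hf)

theorem hasDerivAt_const_sub {f : ℝ → X} {f' : X} (a t : ℝ) (hf : HasDerivAt f f' (a - t)) :
    HasDerivAt (fun s => f (a - s)) (-f') t := hf.comp_const_sub a t

theorem sine_neg (hC : IsCosineFunction C) (t : ℝ) (z : X) : hC.sine (-t) z = -hC.sine t z := by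
  refine eq_of_hasDerivAt_eq (f := fun t => hC.sine (-t) z) (g := fun t => -hC.sine t z)
    (f' := fun t => -C t z) (fun t => ?_) (fun t => (hC.hasDerivAt_sine z t).neg) ?_ t
  · have := hasDerivAt_const_sub 0 t (hC.hasDerivAt_sine z (0 - t))
    simpa [hC.apply_neg] using this
  · simp [hC.sine_zero]

theorem sineIntegral_neg (hC : IsCosineFunction C) (t : ℝ) (z : X) :
    hC.sineIntegral (-t) z = hC.sineIntegral t z := by
  refine eq_of_hasDerivAt_eq (f := fun t => hC.sineIntegral (-t) z)
    (g := fun t => hC.sineIntegral t z)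
    (f' := fun t => hC.sine t z) (fun t => ?_) (fun t => (hC.hasDerivAt_sineIntegral z t)) ?_ t
  · have := hasDerivAt_const_sub 0 t (hC.hasDerivAt_sineIntegral z (0 - t))
    simpa [hC.sine_neg] using this
  · simp

/-- d'Alembert's equation integrated in `t`: the derivatives agree, and both sides vanish at `t = 0`
because the sine function is odd. -/
theorem apply_sine (hC : IsCosineFunction C) (τ t : ℝ) (z : X) :
    C τ (hC.sine t z) = (1 / 2 : ℝ) • (hC.sine (t + τ) z + hC.sine (t - τ) z) := by
  refine eq_of_hasDerivAt_eq (f := fun t => C τ (hC.sine t z))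
    (g := fun t => (1 / 2 : ℝ) • (hC.sine (t + τ) z + hC.sine (t - τ) z))
    (f' := fun t => C τ (C t z)) (fun t => hasDerivAt_clm_apply _ (hC.hasDerivAt_sine z t))
    (fun t => ?_) ?_ t
  · rw [hC.apply_apply']
    exact hasDerivAt_half_smul (fun _ => rfl) ((hC.hasDerivAt_sine z (t + τ)).comp_add_const t τ)
      ((hC.hasDerivAt_sine z (t - τ)).comp_sub_const t τ)
  · simp [hC.sine_zero, hC.sine_neg]

theorem sine_apply_comm (hC : IsCosineFunction C) (τ t : ℝ) (z : X) :
    hC.sine t (C τ z) = C τ (hC.sine t z) := by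
  refine eq_of_hasDerivAt_eq (f := fun t => hC.sine t (C τ z)) (g := fun t => C τ (hC.sine t z))
    (hC.hasDerivAt_sine (C τ z)) (fun t => ?_) ?_ t
  · rw [hC.apply_comm]
    exact hasDerivAt_clm_apply _ (hC.hasDerivAt_sine z t)
  · simp [hC.sine_zero]

theorem sineIntegral_apply_comm (hC : IsCosineFunction C) (τ t : ℝ) (z : X) :
    hC.sineIntegral t (C τ z) = C τ (hC.sineIntegral t z) := by
  refine eq_of_hasDerivAt_eq (f := fun t => hC.sineIntegral t (C τ z))
    (g := fun t => C τ (hC.sineIntegral t z))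
    (hC.hasDerivAt_sineIntegral (C τ z)) (fun t => ?_) ?_ t
  · rw [hC.sine_apply_comm]
    exact hasDerivAt_clm_apply _ (hC.hasDerivAt_sineIntegral z t)
  · simp [hC.sineIntegral_zero]

/-- A second integration in `t`. The double integral is even, so the constant of integration is
`-hC.sineIntegral τ z`. -/
theorem apply_sineIntegral (hC : IsCosineFunction C) (τ t : ℝ) (z : X) :
    C τ (hC.sineIntegral t z) = (1 / 2 : ℝ) • (hC.sineIntegral (t + τ) z +
      hC.sineIntegral (t - τ) z) - hC.sineIntegral τ z := by
  refine eq_of_hasDerivAt_eq (f := fun t => C τ (hC.sineIntegral t z))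
    (g := fun t => (1 / 2 : ℝ) • (hC.sineIntegral (t + τ) z + hC.sineIntegral (t - τ) z) -
      hC.sineIntegral τ z)
    (f' := fun t => C τ (hC.sine t z))
    (fun t => hasDerivAt_clm_apply _ (hC.hasDerivAt_sineIntegral z t)) (fun t => ?_) ?_ t
  · rw [hC.apply_sine]
    exact (hasDerivAt_half_smul (fun _ => rfl)
      ((hC.hasDerivAt_sineIntegral z (t + τ)).comp_add_const t τ)
      ((hC.hasDerivAt_sineIntegral z (t - τ)).comp_sub_const t τ)).sub_const _
  · simp only [hC.sineIntegral_zero, zero_add, zero_sub, hC.sineIntegral_neg, _root_.map_zero]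
    module

/-- On the domain of its generator, a cosine function is a twofold integral. -/
theorem apply_eq_add_sineIntegral (hC : IsCosineFunction C) {z w : X}
    (h : Tendsto (fun t : ℝ => (2 / t ^ 2) • (C t z - z)) (𝓝[≠] 0) (𝓝 w)) (t : ℝ) :
    C t z = z + hC.sineIntegral t w := by
  have h1 : Tendsto (fun τ : ℝ => hC.sineIntegral t ((2 / τ ^ 2) • (C τ z - z))) (𝓝[≠] 0)
      (𝓝 (hC.sineIntegral t w)) := ((hC.sineIntegral t).continuous.tendsto w).comp h
  -- The limit in `h1` is computed a second way: `τ ↦ C τ (hC.sineIntegral t z)` is explicit, with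
  -- second derivative `C t z - z` at `0`.
  have h2 : Tendsto (fun τ : ℝ => (2 / τ ^ 2) • ((1 / 2 : ℝ) • (hC.sineIntegral (t + τ) z +
      hC.sineIntegral (t - τ) z) - hC.sineIntegral τ z - hC.sineIntegral t z)) (𝓝[≠] 0)
      (𝓝 (C t z - z)) := by
    refine tendsto_two_div_sq_smul (ψ := fun τ => (1 / 2 : ℝ) • (hC.sine (t + τ) z +
      -hC.sine (t - τ) z) - hC.sine τ z) (fun τ => ?_) ?_ ?_ ?_
    · exact ((hasDerivAt_half_smul (fun _ => rfl)
        ((hC.hasDerivAt_sineIntegral z (t + τ)).comp_const_add t τ)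
        (hasDerivAt_const_sub t τ (hC.hasDerivAt_sineIntegral z (t - τ)))).sub
          (hC.hasDerivAt_sineIntegral z τ)).sub_const _
    · simp only [add_zero, sub_zero, hC.sineIntegral_zero]
      module
    · simp only [add_zero, sub_zero, hC.sine_zero]
      module
    · have h3 := (hasDerivAt_half_smul (fun _ => rfl)
        ((hC.hasDerivAt_sine z (t + 0)).comp_const_add t 0)
        (hasDerivAt_const_sub t 0 (hC.hasDerivAt_sine z (t - 0))).neg).sub (hC.hasDerivAt_sine z 0)
      refine h3.congr_deriv ?_
      simp only [add_zero, sub_zero, hC.apply_zero]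
      module
  have h4 := tendsto_nhds_unique (h1.congr fun τ => ?_) h2
  · rw [h4]; abel
  · rw [(hC.sineIntegral t).map_smul_of_tower, map_sub, hC.sineIntegral_apply_comm,
      hC.apply_sineIntegral]

end IsCosineFunction

/-- A bounded operator with values in the range of an injective bounded operator `ι` factors
through `ι`. -/
theorem exists_lift_clm {Z : Type*} [NormedAddCommGroup Z] [NormedSpace 𝕜 Z] [CompleteSpace Z]
    [CompleteSpace Y] {ι : Y →L[𝕜] X} (hι : Function.Injective ι) (Φ : Z →L[𝕜] X)
    (h : ∀ z, Φ z ∈ range ι) : ∃ Ψ : Z →L[𝕜] Y, ∀ z, ι (Ψ z) = Φ z := by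
  choose f hf using h
  let g : Z →ₗ[𝕜] Y :=
    { toFun := f
      map_add' := fun a b => hι (by simp [hf])
      map_smul' := fun c a => hι (by simp [hf]) }
  refine ⟨⟨g, g.continuous_of_seq_closed_graph fun u x y hu hy => hι ?_⟩, hf⟩
  have h1 : Tendsto (fun n => ι (g (u n))) atTop (𝓝 (ι y)) := (ι.continuous.tendsto y).comp hy
  have h2 : Tendsto (fun n => Φ (u n)) atTop (𝓝 (Φ x)) := (Φ.continuous.tendsto x).comp hu
  have h3 : ∀ n, ι (g (u n)) = Φ (u n) := fun n => hf (u n)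
  simp only [h3] at h1
  rw [tendsto_nhds_unique h1 h2]
  exact (hf x).symm

/-- Pointwise derivatives of families of bounded operators are bounded operators. -/
theorem exists_deriv_clm [CompleteSpace Y] {Φ : ℝ → Y →L[𝕜] X} (t : ℝ)
    (h : ∀ v, DifferentiableAt ℝ (fun s => Φ s v) t) :
    ∃ Ψ : Y →L[𝕜] X, ∀ v, HasDerivAt (fun s => Φ s v) (Ψ v) t := by
  have h1 : Tendsto (fun (r : ℝ) (v : Y) => (((r⁻¹ : ℝ) : 𝕜) • (Φ (t + r) - Φ t)) v) (𝓝[≠] 0)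
      (𝓝 fun v => deriv (fun s => Φ s v) t) := by
    rw [tendsto_pi_nhds]
    intro v
    have := hasDerivAt_iff_tendsto_slope_zero.1 (h v).hasDerivAt
    refine this.congr fun r => ?_
    rw [RCLike.real_smul_eq_coe_smul (K := 𝕜)]
    simp
  exact ⟨continuousLinearMapOfTendsto _ h1, fun v => (h v).hasDerivAt⟩

/-- By the equivalent norm, continuity into `Y` means continuity into `X` together with continuity
of `t ↦ D t` uniformly on `[0, 1]`. Joint continuity of `D` gives the latter, as a continuous curve
in `C([0, 1], X)`. -/
theorem IsPhaseSpace.continuous {C : ℝ → X →L[𝕜] X} {ι : Y →L[𝕜] X} (hP : IsPhaseSpace C ι)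
    {w : ℝ → Y} {D : ℝ → ℝ → X} (hD : ∀ t τ, HasDerivAt (fun s => C s (ι (w t))) (D t τ) τ)
    (hDc : Continuous (Function.uncurry D)) (hw : Continuous fun t => ι (w t)) :
    Continuous w := by
  obtain ⟨-, c, K, hc, hcK⟩ := hP
  let g : ℝ → C(Icc (0 : ℝ) 1, X) := fun t =>
    ⟨fun τ => D t τ, hDc.comp (continuous_const.prodMk continuous_subtype_val)⟩
  have hg : Continuous g := by
    refine ContinuousMap.continuous_of_continuous_uncurry _ ?_
    exact hDc.comp (continuous_fst.prodMk (continuous_subtype_val.comp continuous_snd))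
  refine continuous_iff_continuousAt.2 fun t₀ => ?_
  have hle : ∀ t, ‖w t - w t₀‖ ≤ c⁻¹ * (‖ι (w t) - ι (w t₀)‖ + ‖g t - g t₀‖) := by
    intro t
    have h1 := (hcK (w t - w t₀)).1
    have h2 : (⨆ τ : Icc (0 : ℝ) 1, ‖deriv (fun s => C s (ι (w t - w t₀))) τ‖) ≤ ‖g t - g t₀‖ := by
      refine ciSup_le fun τ => ?_
      have h3 : HasDerivAt (fun s => C s (ι (w t - w t₀))) (D t τ - D t₀ τ) τ := by
        simpa using! (hD t τ).sub (hD t₀ τ)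
      rw [h3.deriv]
      exact (g t - g t₀).norm_coe_le_norm τ
    rw [le_inv_mul_iff₀ hc]
    refine h1.trans ?_
    rw [map_sub]
    gcongr
    simpa using h2
  rw [ContinuousAt, tendsto_iff_norm_sub_tendsto_zero]
  refine squeeze_zero (fun _ => norm_nonneg _) hle ?_
  have h4 := tendsto_iff_norm_sub_tendsto_zero.1 (hw.tendsto t₀)
  have h5 := tendsto_iff_norm_sub_tendsto_zero.1 (hg.tendsto t₀)
  simpa using (h4.add h5).const_mul c⁻¹

end Cosine

section PhaseSpaceGroup

variable {𝕜 X Y : Type*} [RCLike 𝕜]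
  [NormedAddCommGroup X] [NormedSpace ℝ X] [NormedSpace 𝕜 X] [IsScalarTower ℝ 𝕜 X]
  [NormedAddCommGroup Y] [NormedSpace ℝ Y] [NormedSpace 𝕜 Y] [IsScalarTower ℝ 𝕜 Y]
  [CompleteSpace X] [CompleteSpace Y]

/-- A cosine function with phase space `Y × X` gives rise to a group on `Y × X`, whose generator
is the operator matrix `(0 I; G 0)`. -/
theorem IsCosineFunction.exists_phaseSpaceGroup {C : ℝ → X →L[𝕜] X} (hC : IsCosineFunction C)
    {G : X →ₗ.[𝕜] X} (hG : IsCosineGenerator C G) {ι : Y →L[𝕜] X}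
    (hι : Function.Injective ι) (hP : IsPhaseSpace C ι) :
    ∃ U : ℝ → (Y × X) →L[𝕜] (Y × X), IsC0Group U ∧ ∀ p q : Y × X,
      HasDerivAt (fun t => U t p) q 0 ↔ ι q.1 = p.2 ∧ (ι p.1, q.2) ∈ G.graph := by
  have hsmooth : ∀ v, ContDiff ℝ 1 fun t => C t (ι v) := fun v => (hP.1 _).1 ⟨v, rfl⟩
  have hrange : ∀ {z : X} {f' : ℝ → X}, (∀ t, HasDerivAt (fun t => C t z) (f' t) t) →
      Continuous f' → z ∈ range ι := fun {z f'} h h' => (hP.1 z).2 (by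
    rw [contDiff_one_iff_deriv]
    refine ⟨fun t => (h t).differentiableAt, ?_⟩
    rwa [show deriv (fun t => C t z) = f' from funext fun t => (h t).deriv])
  -- the derivative of the cosine function on `Y`
  choose C' hC' using fun t => exists_deriv_clm (Φ := fun s => (C s).comp ι) t
    (fun v => ((hsmooth v).differentiable one_ne_zero).differentiableAt)
  replace hC' : ∀ t v, HasDerivAt (fun s => C s (ι v)) (C' t v) t := hC'
  have hC'c : ∀ v, Continuous fun t => C' t v := fun v => by
    have h := (hsmooth v).continuous_deriv le_rfl
    rwa [show deriv (fun t => C t (ι v)) = fun t => C' t v from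
      funext fun t => (hC' t v).deriv] at h
  have hC'neg : ∀ t v, C' (-t) v = -C' t v := fun t v => by
    have h1 := IsCosineFunction.hasDerivAt_const_sub 0 (-t) (f := fun s => C s (ι v))
      (by simpa using hC' t v)
    simp only [zero_sub, hC.apply_neg] at h1
    exact (hC' (-t) v).unique h1
  have hC'zero : ∀ v, C' 0 v = 0 := fun v => by
    have h := hC'neg 0 v
    rw [neg_zero] at h
    have h' : (2 : ℝ) • C' 0 v = 0 := by rw [two_smul]; nth_rewrite 1 [h]; exact neg_add_cancel _
    exact (smul_eq_zero.1 h').resolve_left two_ne_zero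
  -- its lifts to `Y`
  have hdC : ∀ t v τ, HasDerivAt (fun s => C s (C t (ι v)))
      ((1 / 2 : ℝ) • (C' (τ + t) v + C' (τ - t) v)) τ := fun t v τ =>
    IsCosineFunction.hasDerivAt_half_smul (fun s => hC.apply_apply t s (ι v))
      ((hC' (τ + t) v).comp_add_const τ t) ((hC' (τ - t) v).comp_sub_const τ t)
  have hdS : ∀ t z τ, HasDerivAt (fun s => C s (hC.sine t z))
      ((1 / 2 : ℝ) • (C (t + τ) z + -C (t - τ) z)) τ := fun t z τ =>
    IsCosineFunction.hasDerivAt_half_smul (fun s => hC.apply_sine s t z)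
      ((hC.hasDerivAt_sine z (t + τ)).comp_const_add t τ)
      (IsCosineFunction.hasDerivAt_const_sub t τ (hC.hasDerivAt_sine z (t - τ)))
  have hCc := hC.strongly_continuous
  -- The derivatives just computed are continuous, so the phase space property shows that `C t`
  -- preserves `Y` and `S t` maps `X` into `Y`.
  choose CY hCY using fun t => exists_lift_clm hι ((C t).comp ι) fun v =>
    hrange (hdC t v) (((hC'c v).comp (continuous_add_const t)).add
      ((hC'c v).comp (continuous_sub_right t)) |>.const_smul _)
  choose SY hSY using fun t => exists_lift_clm hι (hC.sine t) fun z =>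
    hrange (hdS t z) (((hCc z).comp (continuous_const_add t)).add
      ((hCc z).comp (continuous_sub_left t)).neg |>.const_smul _)
  simp only [ContinuousLinearMap.comp_apply] at hCY
  have hCYc : ∀ v, Continuous fun t => CY t v := fun v => by
    refine hP.continuous (D := fun t τ => (1 / 2 : ℝ) • (C' (τ + t) v + C' (τ - t) v))
      (fun t τ => by simpa only [hCY] using hdC t v τ) ?_ (by simpa only [hCY] using hCc (ι v))
    exact (((hC'c v).comp (continuous_snd.add continuous_fst)).add
      ((hC'c v).comp (continuous_snd.sub continuous_fst))).const_smul _
  have hSYc : ∀ z, Continuous fun t => SY t z := fun z => by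
    refine hP.continuous (D := fun t τ => (1 / 2 : ℝ) • (C (t + τ) z + -C (t - τ) z))
      (fun t τ => by simpa only [hSY] using hdS t z τ) ?_
      (by simpa only [hSY] using hC.continuous_sine z)
    exact (((hCc z).comp (continuous_fst.add continuous_snd)).add
      ((hCc z).comp (continuous_fst.sub continuous_snd)).neg).const_smul _
  -- functional equations
  have e1 : ∀ s t v, C t (C' s v) = (1 / 2 : ℝ) • (C' (s + t) v + C' (s - t) v) := fun s t v =>
    (hasDerivAt_clm_apply (C t) (hC' s v)).unique
      (IsCosineFunction.hasDerivAt_half_smul (fun r => hC.apply_apply' r t (ι v))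
        ((hC' (s + t) v).comp_add_const s t) ((hC' (s - t) v).comp_sub_const s t))
  have e2 : ∀ s t v, C' t (CY s v) = (1 / 2 : ℝ) • (C' (t + s) v + C' (t - s) v) := fun s t v => by
    have h := hC' t (CY s v)
    simp only [hCY] at h
    exact h.unique (hdC s v t)
  have e3 : ∀ s t z, C' t (SY s z) = (1 / 2 : ℝ) • (C (s + t) z + -C (s - t) z) := fun s t z => by
    have h := hC' t (SY s z)
    simp only [hSY] at h
    exact h.unique (hdS s z t)
  have e4 : ∀ s t v, hC.sine t (C' s v) = (1 / 2 : ℝ) • (C (s + t) (ι v) + -C (s - t) (ι v)) :=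
    fun s t v => by
    refine eq_of_hasDerivAt_eq (f := fun t => hC.sine t (C' s v))
      (g := fun t => (1 / 2 : ℝ) • (C (s + t) (ι v) + -C (s - t) (ι v)))
      (hC.hasDerivAt_sine _) (fun r => ?_) ?_ t
    · rw [e1]
      have := IsCosineFunction.hasDerivAt_half_smul (f := fun t => (1 / 2 : ℝ) • (C (s + t) (ι v) +
        -C (s - t) (ι v))) (fun _ => rfl) ((hC' (s + r) v).comp_const_add s r)
        (IsCosineFunction.hasDerivAt_const_sub s r (hC' (s - r) v)).neg
      simpa using this
    · simp [hC.sine_zero]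
  -- The matrix `(C S; C' C)` sends initial position and velocity to position and velocity at time
  -- `t`.
  let U : ℝ → (Y × X) →L[𝕜] (Y × X) := fun t =>
    ((CY t).coprod (SY t)).prod ((C' t).coprod (C t))
  have hUapply : ∀ t p, U t p = (CY t p.1 + SY t p.2, C' t p.1 + C t p.2) := fun t p => rfl
  refine ⟨U, ⟨?_, ?_, ?_⟩, ?_⟩
  · refine ContinuousLinearMap.ext fun p => ?_
    rw [hUapply, hC'zero, hC.apply_zero, zero_add]
    refine Prod.ext (hι ?_) rfl
    simp [hCY, hSY, hC.sine_zero, hC.apply_zero]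
  · intro s t
    refine ContinuousLinearMap.ext fun p => ?_
    rw [ContinuousLinearMap.comp_apply, hUapply, hUapply, hUapply]
    refine Prod.ext (hι ?_) ?_
    · simp only [map_add, hCY, hSY]
      rw [hC.sine_apply_comm, e4, hC.apply_sine, hC.apply_sine, hC.apply_apply',
        ← neg_sub s t, hC.sine_neg, add_comm s t]
      module
    · simp only [map_add]
      rw [e1, e2, e3, hC.apply_apply', ← neg_sub s t, hC'neg, hC.apply_neg,
        add_comm s t]
      module
  · intro p
    exact ((hCYc p.1).add (hSYc p.2)).prodMk ((hC'c p.1).add (hCc p.2))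
  · rintro ⟨w, v⟩ ⟨a, b⟩
    simp only [hUapply]
    constructor
    · intro h
      have h1 := hasDerivAt_clm_apply (ι.comp (ContinuousLinearMap.fst 𝕜 Y X)) h
      have h2 := hasDerivAt_clm_apply (ContinuousLinearMap.snd 𝕜 Y X) h
      simp only [ContinuousLinearMap.comp_apply, ContinuousLinearMap.coe_fst', map_add, hCY, hSY,
        ContinuousLinearMap.coe_snd'] at h1 h2
      have h3 := (hC' 0 w).add (hC.hasDerivAt_sine v 0)
      have h4 : ι a = v := by
        rw [h1.unique h3, hC'zero, hC.apply_zero, zero_add]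
      refine ⟨h4, (hG _ _).2 ?_⟩
      -- Since `v = ι a`, the summand `C t v` is differentiable at `0` with derivative `C' 0 a = 0`,
      -- so `C' t w` carries the whole derivative.
      have h5 : HasDerivAt (fun t => C' t w) b 0 := by
        have h6 := h2.sub (hC' 0 a)
        rw [hC'zero, sub_zero] at h6
        refine h6.congr_of_eventuallyEq (Eventually.of_forall fun t => ?_)
        simp [h4]
      exact tendsto_two_div_sq_smul (fun t => (hC' t w).sub_const (ι w)) (by simp [hC.apply_zero])
        (hC'zero w) h5
    · rintro ⟨h1, h2⟩
      subst h1
      have h3 := hC.apply_eq_add_sineIntegral ((hG _ _).1 h2)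
      have h4 : ∀ t, C' t w = hC.sine t b := fun t =>
        (hC' t w).unique (((hC.hasDerivAt_sineIntegral b t).const_add (ι w)).congr_of_eventuallyEq
          (Eventually.of_forall h3))
      -- The first component must be differentiated in `Y`, not just in `X`; hence both of its
      -- summands are written as integrals of `Y`-continuous orbits.
      have h5 : ∀ t, CY t w = w + integralCLM SY hSYc t b := fun t => hι (by
        rw [hCY, h3, map_add]
        congr 1
        exact eq_of_hasDerivAt_eq (f := fun t => hC.sineIntegral t b)
          (g := fun t => ι (integralCLM SY hSYc t b)) (hC.hasDerivAt_sineIntegral b)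
          (fun s => by
            have := hasDerivAt_clm_apply ι (hasDerivAt_integralCLM hSYc b s)
            rwa [hSY] at this) (by simp [hC.sineIntegral_zero, integralCLM_zero]) t)
      have h6 : ∀ t, SY t (ι a) = integralCLM CY hCYc t a := fun t => hι (by
        rw [hSY]
        exact eq_of_hasDerivAt_eq (f := fun t => hC.sine t (ι a))
          (g := fun t => ι (integralCLM CY hCYc t a)) (hC.hasDerivAt_sine (ι a))
          (fun s => by
            have := hasDerivAt_clm_apply ι (hasDerivAt_integralCLM hCYc a s)
            rwa [hCY] at this) (by simp [hC.sine_zero, integralCLM_zero]) t)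
      have hSY0 : SY 0 b = 0 := hι (by simp [hSY, hC.sine_zero])
      have hCY0 : CY 0 a = a := hι (by simp [hCY, hC.apply_zero])
      refine HasDerivAt.prodMk ?_ ?_
      · simp only [h5, h6]
        have := ((hasDerivAt_integralCLM hSYc b 0).const_add w).add
          (hasDerivAt_integralCLM hCYc a 0)
        rwa [hSY0, hCY0, zero_add] at this
      · simp only [h4]
        have := (hC.hasDerivAt_sine b 0).add (hC' 0 a)
        rwa [hC.apply_zero, hC'zero, add_zero] at this

end PhaseSpaceGroup

/-! ### Well-posedness from generation -/

section WellPosed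

variable {𝕜 E F : Type*} [RCLike 𝕜]
  [NormedAddCommGroup E] [NormedSpace ℝ E] [NormedSpace 𝕜 E] [IsScalarTower ℝ 𝕜 E]
  [NormedAddCommGroup F] [NormedSpace ℝ F] [NormedSpace 𝕜 F] [IsScalarTower ℝ 𝕜 F]

theorem contDiff_clm_apply (Φ : E →L[𝕜] F) {f : ℝ → E} {n : WithTop ℕ∞} (hf : ContDiff ℝ n f) :
    ContDiff ℝ n fun t => Φ (f t) :=
  (Φ.restrictScalars ℝ).contDiff.comp hf

theorem contDiff_one_of_hasDerivAt {f f' : ℝ → E} (h : ∀ t, HasDerivAt f (f' t) t)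
    (h' : Continuous f') : ContDiff ℝ 1 f := by
  rw [contDiff_one_iff_deriv]
  refine ⟨fun t => (h t).differentiableAt, ?_⟩
  rwa [show deriv f = f' from funext fun t => (h t).deriv]

theorem contDiff_two_of_hasDerivAt {f f' : ℝ → E} (h : ∀ t, HasDerivAt f (f' t) t)
    (h' : ContDiff ℝ 1 f') : ContDiff ℝ 2 f := by
  have hd : deriv f = f' := funext fun t => (h t).deriv
  rw [show (2 : WithTop ℕ∞) = 1 + 1 by norm_num, contDiff_succ_iff_deriv]
  refine ⟨fun t => (h t).differentiableAt, by simp, ?_⟩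
  rwa [hd]

variable {dE : Type*} [NormedAddCommGroup dE] [NormedSpace ℝ dE] [NormedSpace 𝕜 dE]
  [IsScalarTower ℝ 𝕜 dE]

namespace FirstOrderProblem

variable (P : FirstOrderProblem 𝕜 E dE)

theorem mem_graph_matrix_iff (z w : E × dE) : (z, w) ∈ P.matrix.graph ↔
    ∃ h : z.1 ∈ P.op.domain, P.bdry ⟨z.1, h⟩ = z.2 ∧ P.op ⟨z.1, h⟩ = w.1 ∧
      P.feedback z.1 + P.bdryOp z.2 = w.2 := by
  rw [matrix, mem_graph_paramOp]
  constructor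
  · rintro ⟨p, hp⟩
    obtain ⟨rfl, rfl⟩ := Prod.ext_iff.1 hp
    exact ⟨p.2, rfl, rfl, rfl⟩
  · rintro ⟨h, h1, h2, h3⟩
    refine ⟨⟨z.1, h⟩, Prod.ext (Prod.ext rfl h1) (Prod.ext h2 ?_)⟩
    rw [← h3, ← h1]
    rfl

variable {P} in
theorem IsClassicalSolution.hasDerivAt {u₀ : E} {x₀ : dE} {u : ℝ → E}
    (hu : P.IsClassicalSolution u₀ x₀ u) (t : ℝ) :
    HasDerivAt (fun t => (u t, P.bdry ⟨u t, hu.mem t⟩))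
      (P.op ⟨u t, hu.mem t⟩, P.feedback (u t) + P.bdryOp (P.bdry ⟨u t, hu.mem t⟩)) t := by
  rw [← hu.deriv_eq, ← hu.deriv_bdry_eq]
  exact ((hu.contDiff.differentiable one_ne_zero) t).hasDerivAt.prodMk
    ((hu.contDiff_bdry.differentiable one_ne_zero) t).hasDerivAt

variable [CompleteSpace E] [CompleteSpace dE]

variable {P} in
-- The pair of solution and boundary value is a differentiable curve inside the domain of the
-- matrix. Uniqueness and continuous dependence both follow from this.
theorem IsClassicalSolution.eq_apply {u₀ : E} {x₀ : dE} {u : ℝ → E}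
    (hu : P.IsClassicalSolution u₀ x₀ u) {T : ℝ → (E × dE) →L[𝕜] (E × dE)} (hT : IsC0Group T)
    (hgen : ∀ z w, (z, w) ∈ P.matrix.graph ↔ HasDerivAt (fun t => T t z) w 0) (t : ℝ) :
    (u t, P.bdry ⟨u t, hu.mem t⟩) = T t (u₀, x₀) := by
  have h := hT.eq_of_hasDerivAt hu.hasDerivAt
    (fun s => (hgen _ _).1 ((P.mem_graph_matrix_iff _ _).2 ⟨hu.mem s, rfl, rfl, rfl⟩)) t
  rw [h]
  exact congrArg (T t) (Prod.ext hu.initial hu.initial_bdry)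

/-- A first order problem is well-posed if its operator matrix generates a group. -/
theorem wellPosed_of_generatesC0Group (h : GeneratesC0Group P.matrix) : P.WellPosed := by
  obtain ⟨T, hT, hgen⟩ := h
  refine ⟨?_, ?_, ?_, ?_⟩
  · have h1 : (P.matrix.graph : Set ((E × dE) × (E × dE))) =
        {p | HasDerivAt (fun t => T t p.1) p.2 0} := by
      ext ⟨z, w⟩
      exact hgen z w
    rw [LinearPMap.IsClosed, h1]
    exact hT.isClosed_generator
  · refine hT.dense_generator.mono ?_
    rintro z ⟨w, hw⟩
    exact LinearPMap.mem_domain_of_mem_graph ((hgen z w).2 hw)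
  · intro u₀ hu₀ x₀ hx₀
    have h0 := (hgen (u₀, x₀) (P.op ⟨u₀, hu₀⟩, P.feedback u₀ + P.bdryOp x₀)).1
      ((P.mem_graph_matrix_iff _ _).2 ⟨hu₀, hx₀, rfl, rfl⟩)
    set w : E × dE := (P.op ⟨u₀, hu₀⟩, P.feedback u₀ + P.bdryOp x₀)
    have h1 : ∀ t, HasDerivAt (fun t => T t (u₀, x₀)) (T t w) t := hT.hasDerivAt h0
    -- The orbit stays in the domain of the generator; membership in its graph encodes the coupling
    -- and both equations at once.
    have h2 : ∀ t, ∃ h : (T t (u₀, x₀)).1 ∈ P.op.domain,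
        P.bdry ⟨(T t (u₀, x₀)).1, h⟩ = (T t (u₀, x₀)).2 ∧
        P.op ⟨(T t (u₀, x₀)).1, h⟩ = (T t w).1 ∧
        P.feedback (T t (u₀, x₀)).1 + P.bdryOp (T t (u₀, x₀)).2 = (T t w).2 := fun t =>
      (P.mem_graph_matrix_iff _ _).1 ((hgen _ _).2 (hT.hasDerivAt_apply_zero h0 t))
    choose hmem hb ho hf using h2
    have hfst : ∀ t, HasDerivAt (fun t => (T t (u₀, x₀)).1) (T t w).1 t := fun t =>
      hasDerivAt_clm_apply (ContinuousLinearMap.fst 𝕜 E dE) (h1 t)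
    have hsnd : ∀ t, HasDerivAt (fun t => (T t (u₀, x₀)).2) (T t w).2 t := fun t =>
      hasDerivAt_clm_apply (ContinuousLinearMap.snd 𝕜 E dE) (h1 t)
    have hb' : (fun t => P.bdry ⟨(T t (u₀, x₀)).1, hmem t⟩) = fun t => (T t (u₀, x₀)).2 :=
      funext hb
    refine ⟨fun t => (T t (u₀, x₀)).1, ⟨?_, hmem, ?_, ?_, ?_, ?_, ?_⟩, ?_⟩
    · exact contDiff_one_of_hasDerivAt hfst (continuous_fst.comp (hT.strongly_continuous w))
    · rw [hb']
      exact contDiff_one_of_hasDerivAt hsnd (continuous_snd.comp (hT.strongly_continuous w))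
    · intro t
      rw [(hfst t).deriv, ho]
    · intro t
      rw [hb', (hsnd t).deriv, hb, hf]
    · simp only [hT.apply_zero]
    · rw [hb, hT.apply_zero]
    · intro v hv
      funext t
      exact congrArg Prod.fst (hv.eq_apply hT hgen t)
  · intro a
    obtain ⟨M, hM0, hM⟩ := exists_norm_le_of_stronglyContinuous hT.strongly_continuous a
    -- The product carries the maximum norm, so each of the two summands is bounded by `M * (‖u₀‖ +
    -- ‖x₀‖)`.
    refine ⟨2 * M, fun u₀ x₀ u hu t ht => ?_⟩
    have h1 := hu.eq_apply hT hgen t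
    have h2 : ‖T t (u₀, x₀)‖ ≤ M * (‖u₀‖ + ‖x₀‖) := by
      refine ((T t).le_of_opNorm_le (hM t ht) _).trans ?_
      gcongr
      exact max_le_add_of_nonneg (norm_nonneg _) (norm_nonneg _)
    rw [← h1] at h2
    have h3 := norm_fst_le (u t, P.bdry ⟨u t, hu.mem t⟩)
    have h4 := norm_snd_le (u t, P.bdry ⟨u t, hu.mem t⟩)
    dsimp only at h3 h4
    linarith

end FirstOrderProblem

end WellPosed

/-! ### The acoustic problem -/

namespace AcousticData

variable {𝕜 : Type*} [RCLike 𝕜] {Y X dX : Type*}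
  [NormedAddCommGroup Y] [NormedSpace ℝ Y] [NormedSpace 𝕜 Y] [IsScalarTower ℝ 𝕜 Y]
  [NormedAddCommGroup X] [NormedSpace ℝ X] [NormedSpace 𝕜 X] [IsScalarTower ℝ 𝕜 X]
  [NormedAddCommGroup dX] [NormedSpace ℝ dX] [NormedSpace 𝕜 dX] [IsScalarTower ℝ 𝕜 dX]
  (S : AcousticData 𝕜 Y X dX)

theorem mem_graph_A₀_iff (w : Y) (b : X) : (S.ι w, b) ∈ S.A₀.graph ↔
    ∃ h : w ∈ S.A.domain, S.R ⟨w, h⟩ = 0 ∧ S.A ⟨w, h⟩ = b := by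
  rw [A₀, mem_graph_paramOp]
  constructor
  · rintro ⟨⟨p, hp⟩, h⟩
    obtain ⟨h1, h2⟩ := Prod.ext_iff.1 h
    obtain rfl : (p : Y) = w := S.ι_injective h1
    exact ⟨p.2, hp, h2⟩
  · rintro ⟨h, h1, h2⟩
    exact ⟨⟨⟨w, h⟩, h1⟩, Prod.ext rfl h2⟩

theorem mem_firstOrder_domain {u : Y} (hu : u ∈ S.A.domain) (v : Y) (y : dX) :
    (u, S.ι v, y) ∈ S.firstOrder.op.domain := ⟨(⟨u, hu⟩, v, y), rfl⟩

theorem firstOrder_apply {z : Y × X × dX} (hz : z ∈ S.firstOrder.op.domain) :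
    ∃ hu : z.1 ∈ S.A.domain, S.ι (S.firstOrder.op ⟨z, hz⟩).1 = z.2.1 ∧
      (S.firstOrder.op ⟨z, hz⟩).2.1 = S.A ⟨z.1, hu⟩ ∧
      (S.firstOrder.op ⟨z, hz⟩).2.2 = S.L ⟨z.1, hu⟩ ∧
      S.firstOrder.bdry ⟨z, hz⟩ = S.R ⟨z.1, hu⟩ := by
  obtain ⟨⟨u, v, y⟩, rfl⟩ := hz
  have h : (LinearEquiv.ofInjective S.incl S.incl_injective).symm
      ⟨S.incl (u, v, y), ⟨(u, v, y), rfl⟩⟩ = (u, v, y) :=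
    (LinearEquiv.ofInjective S.incl S.incl_injective).symm_apply_apply (u, v, y)
  have h1 : S.firstOrder.op ⟨S.incl (u, v, y), ⟨(u, v, y), rfl⟩⟩ = (v, S.A u, S.L u) :=
    congrArg (fun p : S.A.domain × Y × dX => (p.2.1, S.A p.1, S.L p.1)) h
  refine ⟨u.2, ?_, ?_, ?_, ?_⟩
  · rw [h1]; rfl
  · rw [h1]; rfl
  · rw [h1]; rfl
  · exact congrArg (fun p : S.A.domain × Y × dX => S.R p.1) h

theorem firstOrder_feedback_apply (z : Y × X × dX) :
    S.firstOrder.feedback z = S.B₁ z.1 + S.B₄ (S.B₂ z.1) + S.B₃ z.2.2 := rfl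

theorem L_apply {u : Y} (hu : u ∈ S.A.domain) : S.L ⟨u, hu⟩ = S.R ⟨u, hu⟩ + S.B₂ u := rfl

theorem mem_graph_matrix_iff (u a : Y) (v b : X) (y c x d : dX) :
    (((u, v, y), x), ((a, b, c), d)) ∈ S.firstOrder.matrix.graph ↔
      ∃ hu : u ∈ S.A.domain, S.R ⟨u, hu⟩ = x ∧ S.ι a = v ∧ S.A ⟨u, hu⟩ = b ∧
        x + S.B₂ u = c ∧ S.B₁ u + S.B₄ (S.B₂ u) + S.B₃ y + S.B₄ x = d := by
  rw [FirstOrderProblem.mem_graph_matrix_iff]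
  constructor
  · rintro ⟨h, h1, h2, h3⟩
    obtain ⟨hu, e1, e2, e3, e4⟩ := S.firstOrder_apply h
    rw [h2] at e1 e2 e3
    rw [h1] at e4
    exact ⟨hu, e4.symm, e1, e2.symm, (congrArg (· + S.B₂ u) e4).trans e3.symm, h3⟩
  · rintro ⟨hu, h1, rfl, h2, h3, h4⟩
    obtain ⟨hu', e1, e2, e3, e4⟩ := S.firstOrder_apply (S.mem_firstOrder_domain hu a y)
    refine ⟨S.mem_firstOrder_domain hu a y, e4.trans h1, ?_, h4⟩
    refine Prod.ext (S.ι_injective e1) (Prod.ext (e2.trans h2) (e3.trans ?_))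
    rw [L_apply, h1, h3]

/-! #### The second order problem and its first order reformulation -/

variable {S}

theorem IsClassicalSolution.ι_deriv {f g : Y} {h j : dX} {u : ℝ → Y} {x : ℝ → dX}
    (hu : S.IsClassicalSolution f g h j u x) :
    (deriv fun t => S.ι (u t)) = fun t => S.ι (deriv u t) :=
  funext fun t => (hasDerivAt_clm_apply S.ι
    ((hu.contDiff_one.differentiable one_ne_zero) t).hasDerivAt).deriv

/-- The boundary component is `R u = x' - B₂ u`, whence the initial value `j - B₂ f`.
Differentiating it cancels `B₂ u'`, and writing `B₄ x' = B₄ (R u) + B₄ B₂ u` produces the feedback.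
-/
theorem IsClassicalSolution.firstOrder {f g : Y} {h j : dX} {u : ℝ → Y} {x : ℝ → dX}
    (hu : S.IsClassicalSolution f g h j u x) :
    S.firstOrder.IsClassicalSolution (f, S.ι g, h) (j - S.B₂ f)
      (fun t => (u t, S.ι (deriv u t), x t)) := by
  have hmem : ∀ t, (u t, S.ι (deriv u t), x t) ∈ S.firstOrder.op.domain := fun t =>
    S.mem_firstOrder_domain (hu.mem t) _ _
  have hud : ∀ t, HasDerivAt u (deriv u t) t := fun t =>
    ((hu.contDiff_one.differentiable one_ne_zero) t).hasDerivAt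
  have hιud : ContDiff ℝ 1 fun t => S.ι (deriv u t) := by
    rw [← hu.ι_deriv]
    exact hu.contDiff_two.deriv'
  have hb : (fun t => S.firstOrder.bdry ⟨_, hmem t⟩) = fun t => S.L ⟨u t, hu.mem t⟩ - S.B₂ (u t) :=
    funext fun t => by
      obtain ⟨_, -, -, -, e⟩ := S.firstOrder_apply (hmem t)
      rw [e, L_apply, add_sub_cancel_right]
  have hxd : ∀ t, HasDerivAt x (deriv x t) t := fun t =>
    ((hu.contDiff_bdry.differentiable two_ne_zero) t).hasDerivAt
  have hL : (fun t => S.L ⟨u t, hu.mem t⟩) = deriv x := funext fun t => (hu.coupling t).symm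
  refine ⟨?_, hmem, ?_, fun t => ?_, fun t => ?_, ?_, ?_⟩
  · exact hu.contDiff_one.prodMk (hιud.prodMk (hu.contDiff_bdry.of_le one_le_two))
  · rw [hb]
    exact hu.contDiff_L.sub (contDiff_clm_apply S.B₂ hu.contDiff_one)
  · have h1 := (hud t).prodMk
      (((hιud.differentiable one_ne_zero) t).hasDerivAt.prodMk (hxd t))
    rw [h1.deriv]
    obtain ⟨_, e1, e2, e3, -⟩ := S.firstOrder_apply (hmem t)
    refine Prod.ext (S.ι_injective e1.symm) (Prod.ext ?_ ?_)
    · rw [e2, ← hu.interior, hu.ι_deriv]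
    · rw [e3, ← hu.coupling]
  · rw [hb]
    have h1 : HasDerivAt (fun t => S.L ⟨u t, hu.mem t⟩) (deriv (deriv x) t) t := by
      rw [← hL]
      exact ((hu.contDiff_L.differentiable one_ne_zero) t).hasDerivAt
    have h2 := h1.sub (hasDerivAt_clm_apply S.B₂ (hud t))
    have h3 : S.firstOrder.bdry ⟨_, hmem t⟩ = deriv x t - S.B₂ (u t) := by
      rw [hu.coupling]; exact congrFun hb t
    rw [h3, firstOrder_feedback_apply]
    refine h2.deriv.trans ?_
    rw [hu.boundary]
    change _ = _ + S.B₄ _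
    rw [map_sub]
    abel
  · simp only [hu.initial_u, hu.initial_u', hu.initial_x]
  · refine (congrFun hb 0).trans ?_
    rw [← hu.coupling, hu.initial_x', hu.initial_u]

/-- The extra regularity is built in: `ι u` has the `C¹` derivative given by the second component,
and `x' = L u = R u + B₂ u` is `C¹`. -/
theorem isClassicalSolution_of_firstOrder {f g : Y} {h j : dX} {z : ℝ → Y × X × dX}
    (hz : S.firstOrder.IsClassicalSolution (f, S.ι g, h) (j - S.B₂ f) z) :
    S.IsClassicalSolution f g h j (fun t => (z t).1) (fun t => (z t).2.2) := by
  choose hmem e1 e2 e3 e4 using fun t => S.firstOrder_apply (hz.mem t)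
  simp only [← hz.deriv_eq] at e1 e2 e3
  have hd : ∀ t, HasDerivAt z (deriv z t) t := fun t =>
    ((hz.contDiff.differentiable one_ne_zero) t).hasDerivAt
  have hu : ∀ t, HasDerivAt (fun t => (z t).1) (deriv z t).1 t := fun t =>
    hasDerivAt_clm_apply (ContinuousLinearMap.fst 𝕜 Y (X × dX)) (hd t)
  have hv : ∀ t, HasDerivAt (fun t => (z t).2.1) (S.A ⟨(z t).1, hmem t⟩) t := fun t => by
    rw [← e2]
    exact hasDerivAt_clm_apply ((ContinuousLinearMap.fst 𝕜 X dX).comp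
      (ContinuousLinearMap.snd 𝕜 Y (X × dX))) (hd t)
  have hx : ∀ t, HasDerivAt (fun t => (z t).2.2) (S.L ⟨(z t).1, hmem t⟩) t := fun t => by
    rw [← e3]
    exact hasDerivAt_clm_apply ((ContinuousLinearMap.snd 𝕜 X dX).comp
      (ContinuousLinearMap.snd 𝕜 Y (X × dX))) (hd t)
  have hιu : ∀ t, HasDerivAt (fun t => S.ι (z t).1) (z t).2.1 t := fun t => by
    rw [← e1]
    exact hasDerivAt_clm_apply S.ι (hu t)
  have hu' : (deriv fun t => (z t).1) = fun t => (deriv z t).1 := funext fun t => (hu t).deriv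
  have hx' : (deriv fun t => (z t).2.2) = fun t => S.L ⟨(z t).1, hmem t⟩ :=
    funext fun t => (hx t).deriv
  have hιu' : (deriv fun t => S.ι (z t).1) = fun t => (z t).2.1 := funext fun t => (hιu t).deriv
  have hLb : (fun t => S.L ⟨(z t).1, hmem t⟩) =
      fun t => S.firstOrder.bdry ⟨z t, hz.mem t⟩ + S.B₂ (z t).1 :=
    funext fun t => by rw [L_apply, e4]
  have hLc : ContDiff ℝ 1 fun t => S.L ⟨(z t).1, hmem t⟩ := by
    rw [hLb]
    exact hz.contDiff_bdry.add (contDiff_clm_apply S.B₂ hz.contDiff.fst)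
  refine ⟨contDiff_two_of_hasDerivAt hιu hz.contDiff.snd.fst, hz.contDiff.fst, hmem, hLc,
    contDiff_two_of_hasDerivAt hx hLc, fun t => ?_, fun t => ?_, fun t => (hx t).deriv, ?_, ?_, ?_,
    ?_⟩
  · rw [hιu', (hv t).deriv]
  · have h1 := ((hz.contDiff_bdry.differentiable one_ne_zero) t).hasDerivAt.add
      (hasDerivAt_clm_apply S.B₂ (hu t))
    rw [hx', hLb, hu']
    refine h1.deriv.trans ?_
    rw [hz.deriv_bdry_eq, firstOrder_feedback_apply]
    change _ + S.B₄ _ + _ = _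
    rw [map_add]
    abel
  · rw [hz.initial]
  · apply S.ι_injective
    rw [hu', e1, hz.initial]
  · rw [hz.initial]
  · rw [hx', hLb]
    dsimp only
    rw [hz.initial_bdry, hz.initial, sub_add_cancel]

/-- The second order problem inherits well-posedness from its first order reformulation. -/
theorem wellPosed₂_of_firstOrder (hW : S.firstOrder.WellPosed) : S.WellPosed₂ := by
  refine ⟨?_, ?_, ?_⟩
  · let Φ : (Y × X × dX) × dX → Y × X × dX × dX :=
      fun p => (p.1.1, p.1.2.1, p.1.2.2, p.2 + S.B₂ p.1.1)
    have hΦ : Continuous Φ := by fun_prop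
    have hsurj : Function.Surjective Φ := fun q =>
      ⟨((q.1, q.2.1, q.2.2.1), q.2.2.2 - S.B₂ q.1), by simp [Φ]⟩
    refine (hsurj.denseRange.dense_image hΦ hW.dense).mono ?_
    rintro _ ⟨p, hp, rfl⟩
    obtain ⟨⟨⟨a, b, c⟩, d⟩, hw⟩ := LinearPMap.mem_domain_iff.1 hp
    obtain ⟨hu, h1, h2, -, -, -⟩ := (S.mem_graph_matrix_iff _ _ _ _ _ _ _ _).1 hw
    refine ⟨⟨p.1.1, hu⟩, a, p.1.2.2, ?_⟩
    rw [L_apply, h1, h2]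
  · intro f hf g h j hj
    obtain ⟨_, -, -, -, e⟩ := S.firstOrder_apply (S.mem_firstOrder_domain hf g h)
    obtain ⟨z, hz, huniq⟩ := hW.existsUnique (f, S.ι g, h) (S.mem_firstOrder_domain hf g h)
      (j - S.B₂ f) (by rw [e, ← hj, L_apply, add_sub_cancel_right])
    refine ⟨(fun t => (z t).1, fun t => (z t).2.2), isClassicalSolution_of_firstOrder hz, ?_⟩
    rintro ⟨u, x⟩ hu
    have h1 := huniq _ hu.firstOrder
    rw [← h1]
  · intro T
    obtain ⟨K, hK⟩ := hW.continuous_dependence T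
    -- The first factor comes from three components bounded by `N` and `‖x'‖ ≤ b + ‖B₂‖ N`, the last
    -- from `j - B₂ f`; `K` may be negative, hence `|K|`.
    refine ⟨(3 + ‖S.B₂‖) * (|K| * (1 + ‖S.B₂‖)), fun f g h j u x hu t ht => ?_⟩
    have hmem : (u t, S.ι (deriv u t), x t) ∈ S.firstOrder.op.domain :=
      S.mem_firstOrder_domain (hu.mem t) _ _
    obtain ⟨_, -, -, -, e⟩ := S.firstOrder_apply hmem
    have h1 := hK _ _ _ hu.firstOrder t ht
    set N := ‖(u t, S.ι (deriv u t), x t)‖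
    set b := ‖S.firstOrder.bdry ⟨(u t, S.ι (deriv u t), x t), hmem⟩‖ with hb
    replace h1 : N + b ≤ K * (‖(f, S.ι g, h)‖ + ‖j - S.B₂ f‖) := h1
    have h2 : ‖u t‖ ≤ N := norm_fst_le (u t, S.ι (deriv u t), x t)
    have h3 : ‖(S.ι (deriv u t), x t)‖ ≤ N := norm_snd_le (u t, S.ι (deriv u t), x t)
    have h4 : ‖S.ι (deriv u t)‖ ≤ N := (norm_fst_le (S.ι (deriv u t), x t)).trans h3
    have h5 : ‖x t‖ ≤ N := (norm_snd_le (S.ι (deriv u t), x t)).trans h3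
    have h6 : ‖deriv x t‖ ≤ b + ‖S.B₂‖ * N := by
      rw [hu.coupling, L_apply, hb, e]
      refine (norm_add_le _ _).trans (add_le_add le_rfl ?_)
      exact (S.B₂.le_opNorm _).trans (by gcongr)
    have hN : 0 ≤ N := norm_nonneg _
    have hb0 : 0 ≤ b := norm_nonneg _
    have hB := norm_nonneg S.B₂
    have h7 : ‖(f, S.ι g, h)‖ + ‖j - S.B₂ f‖ ≤ (1 + ‖S.B₂‖) * (‖f‖ + ‖S.ι g‖ + ‖h‖ + ‖j‖) := by
      have h8 : ‖(f, S.ι g, h)‖ ≤ ‖f‖ + (‖S.ι g‖ + ‖h‖) :=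
        (max_le_add_of_nonneg (norm_nonneg _) (norm_nonneg _)).trans
          (add_le_add le_rfl (max_le_add_of_nonneg (norm_nonneg _) (norm_nonneg _)))
      have h9 : ‖j - S.B₂ f‖ ≤ ‖j‖ + ‖S.B₂‖ * ‖f‖ :=
        (norm_sub_le _ _).trans (add_le_add le_rfl (S.B₂.le_opNorm _))
      have h10 : 0 ≤ ‖S.B₂‖ * (‖S.ι g‖ + ‖h‖ + ‖j‖) := by positivity
      linarith
    calc ‖u t‖ + ‖S.ι (deriv u t)‖ + ‖x t‖ + ‖deriv x t‖
        ≤ (3 + ‖S.B₂‖) * (N + b) := by nlinarith [mul_nonneg hB hb0]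
      _ ≤ (3 + ‖S.B₂‖) * (|K| * ((1 + ‖S.B₂‖) * (‖f‖ + ‖S.ι g‖ + ‖h‖ + ‖j‖))) := by
          gcongr
          exact h1.trans (mul_le_mul (le_abs_self K) h7 (by positivity) (abs_nonneg K))
      _ = _ := by ring

end AcousticData

/-! ### Generation -/

section Similarity

variable {𝕜 E F : Type*} [RCLike 𝕜]
  [NormedAddCommGroup E] [NormedSpace ℝ E] [NormedSpace 𝕜 E] [IsScalarTower ℝ 𝕜 E]
  [NormedAddCommGroup F] [NormedSpace ℝ F] [NormedSpace 𝕜 F] [IsScalarTower ℝ 𝕜 F]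

theorem hasDerivAt_equiv_iff (J : E ≃L[𝕜] F) {f : ℝ → E} {w : F} {t : ℝ} :
    HasDerivAt (fun s => J (f s)) w t ↔ HasDerivAt f (J.symm w) t := by
  refine ⟨fun h => ?_, fun h => ?_⟩
  · simpa using hasDerivAt_clm_apply (J.symm : F →L[𝕜] E) h
  · simpa using hasDerivAt_clm_apply (J : E →L[𝕜] F) h

theorem IsC0Group.conj {T : ℝ → E →L[𝕜] E} (hT : IsC0Group T) (J : E ≃L[𝕜] F) :
    IsC0Group fun t => (J : E →L[𝕜] F).comp ((T t).comp (J.symm : F →L[𝕜] E)) := by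
  refine ⟨?_, fun s t => ?_, fun z => J.continuous.comp (hT.strongly_continuous _)⟩
  · ext z
    simp [hT.apply_zero]
  · ext z
    simp [hT.apply_add]

/-- The group `T ⊕ I`. -/
theorem IsC0Group.prodId {T : ℝ → E →L[𝕜] E} (hT : IsC0Group T) :
    IsC0Group fun t => (T t).prodMap (ContinuousLinearMap.id 𝕜 F) := by
  refine ⟨?_, fun s t => ?_, fun z => (hT.strongly_continuous _).prodMk continuous_const⟩
  · refine ContinuousLinearMap.ext fun z => ?_
    exact Prod.ext (hT.apply_zero z.1) rfl
  · refine ContinuousLinearMap.ext fun z => ?_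
    exact Prod.ext (hT.apply_add s t z.1) rfl

theorem hasDerivAt_prodId_iff {T : ℝ → E →L[𝕜] E} (z w : E × F) :
    HasDerivAt (fun t => (T t).prodMap (ContinuousLinearMap.id 𝕜 F) z) w 0 ↔
      HasDerivAt (fun t => T t z.1) w.1 0 ∧ w.2 = 0 := by
  refine ⟨fun h => ⟨?_, ?_⟩, fun h => ?_⟩
  · exact hasDerivAt_clm_apply (ContinuousLinearMap.fst 𝕜 E F) h
  · exact (hasDerivAt_clm_apply (ContinuousLinearMap.snd 𝕜 E F) h).unique (hasDerivAt_const 0 z.2)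
  · have := h.1.prodMk (hasDerivAt_const (0 : ℝ) z.2)
    rwa [← h.2] at this

end Similarity

namespace AcousticData

variable {𝕜 : Type*} [RCLike 𝕜] {Y X dX : Type*}
  [NormedAddCommGroup Y] [NormedSpace ℝ Y] [NormedSpace 𝕜 Y] [IsScalarTower ℝ 𝕜 Y]
  [NormedAddCommGroup X] [NormedSpace ℝ X] [NormedSpace 𝕜 X] [IsScalarTower ℝ 𝕜 X]
  [NormedAddCommGroup dX] [NormedSpace ℝ dX] [NormedSpace 𝕜 dX] [IsScalarTower ℝ 𝕜 dX]
  [CompleteSpace Y] [CompleteSpace X] [CompleteSpace dX]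
  {S : AcousticData 𝕜 Y X dX}

theorem mem_graph_opAR_iff (u : Y) (b : X) (x : dX) : (u, (b, x)) ∈ S.opAR.graph ↔
    ∃ h : u ∈ S.A.domain, S.A ⟨u, h⟩ = b ∧ S.R ⟨u, h⟩ = x := by
  rw [LinearPMap.mem_graph_iff]
  constructor
  · rintro ⟨p, rfl, h2⟩
    exact ⟨p.2, congrArg Prod.fst h2, congrArg Prod.snd h2⟩
  · rintro ⟨h, rfl, rfl⟩
    exact ⟨⟨u, h⟩, rfl, rfl⟩

/-- The phase space group of `A₀`. -/
theorem Assumptions.exists_phaseSpaceGroup (hS : S.Assumptions) :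
    ∃ U : ℝ → (Y × X) →L[𝕜] (Y × X), IsC0Group U ∧ ∀ p q : Y × X,
      HasDerivAt (fun t => U t p) q 0 ↔ S.ι q.1 = p.2 ∧
        ∃ h : p.1 ∈ S.A.domain, S.R ⟨p.1, h⟩ = 0 ∧ S.A ⟨p.1, h⟩ = q.2 := by
  obtain ⟨C, hC, hG, hP⟩ := hS.cosine
  obtain ⟨U, hU, hgen⟩ := hC.exists_phaseSpaceGroup hG S.ι_injective hP
  exact ⟨U, hU, fun p q => by rw [hgen, mem_graph_A₀_iff]⟩

/-- The Dirichlet operator: for some scalar `c` the problem `A u = c u`, `R u = x` has a solution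
that depends linearly and continuously on `x`. -/
theorem Assumptions.exists_dirichlet (hS : S.Assumptions) :
    ∃ (c : 𝕜) (D : dX →L[𝕜] Y), ∀ x, ∃ h : D x ∈ S.A.domain,
      S.A ⟨D x, h⟩ = c • S.ι (D x) ∧ S.R ⟨D x, h⟩ = x := by
  obtain ⟨U, hU, hgen⟩ := hS.exists_phaseSpaceGroup
  obtain ⟨μ, -, hsurj, hinj⟩ := hU.exists_resolvent
  have hcoe : ∀ z : X, ((μ : 𝕜) * (μ : 𝕜)) • z = μ • μ • z := fun z => by
    rw [mul_smul, ← RCLike.real_smul_eq_coe_smul, ← RCLike.real_smul_eq_coe_smul]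
  set c : 𝕜 := (μ : 𝕜) * (μ : 𝕜)
  have hιμ : ∀ y : Y, S.ι (μ • y) = μ • S.ι y := fun y => S.ι.map_smul_of_tower _ _
  -- Eliminating the second component from the resolvent equation with right-hand side `(0, f)`
  -- leaves `(μ² - A₀) p = f`.
  have hsurj' : ∀ f : X, ∃ p : S.A.domain, S.R p = 0 ∧ S.A p = c • S.ι p - f := fun f => by
    obtain ⟨z, hz⟩ := hsurj (0, f)
    obtain ⟨h1, h2, h3, h4⟩ := (hgen _ _).1 hz
    refine ⟨⟨z.1, h2⟩, h3, ?_⟩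
    rw [h4, hcoe, ← hιμ]
    simp only [Prod.fst_sub, Prod.smul_fst, sub_zero] at h1
    simp [h1]
  have hinj' : ∀ p : S.A.domain, S.R p = 0 → S.A p = c • S.ι p → p = 0 := fun p h1 h2 => by
    have := hinj ((p : Y), S.ι (μ • (p : Y))) ((hgen _ _).2 ⟨rfl, p.2, h1, by
      rw [hιμ]
      exact h2.trans (hcoe _)⟩)
    exact Subtype.ext (congrArg Prod.fst this)
  -- Any preimage `u` of `x` under `R` is corrected by the `w ∈ ker R` with `(A - c) w = (A - c) u`.
  have hex : ∀ x : dX, ∃ p : S.A.domain, S.A p = c • S.ι p ∧ S.R p = x := fun x => by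
    obtain ⟨u, hu⟩ := hS.surjective x
    obtain ⟨w, hw0, hw⟩ := hsurj' (c • S.ι u - S.A u)
    refine ⟨u - w, ?_, ?_⟩
    · rw [LinearPMap.map_sub, hw, AddSubgroupClass.coe_sub, map_sub, smul_sub]
      abel
    · rw [map_sub, hu, hw0, sub_zero]
  have huniq : ∀ p q : S.A.domain, S.A p = c • S.ι p → S.A q = c • S.ι q → S.R p = S.R q →
      p = q := fun p q hp hq h => by
    refine sub_eq_zero.1 (hinj' (p - q) (by rw [map_sub, h, sub_self]) ?_)
    rw [LinearPMap.map_sub, hp, hq, AddSubgroupClass.coe_sub, map_sub, smul_sub]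
  choose d hd1 hd2 using hex
  let D : dX →ₗ[𝕜] S.A.domain :=
    { toFun := d
      map_add' := fun x y => huniq _ _ (hd1 _)
        (by rw [LinearPMap.map_add, hd1, hd1, Submodule.coe_add, map_add, smul_add])
        (by rw [map_add, hd2, hd2, hd2])
      map_smul' := fun a x => huniq _ _ (hd1 _)
        (by
          rw [RingHom.id_apply, LinearPMap.map_smul, hd1, Submodule.coe_smul, map_smul,
            smul_comm])
        (by rw [RingHom.id_apply, map_smul, hd2, hd2]) }
  refine ⟨c, ⟨S.A.domain.subtype ∘ₗ D, LinearMap.continuous_of_seq_closed_graph _ ?_⟩,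
    fun x => ⟨(d x).2, hd1 x, hd2 x⟩⟩
  intro x x₀ y hx hy
  -- On the range of `d` the operator `A` acts as `c ι`, so convergence in `Y` forces convergence of
  -- `A`; closedness of `(A; R)` then identifies the limit.
  have h1 : ∀ n, ((d (x n) : Y), (c • S.ι (d (x n)), x n)) ∈ S.opAR.graph := fun n =>
    (mem_graph_opAR_iff _ _ _).2 ⟨(d (x n)).2, hd1 _, hd2 _⟩
  have hy' : Tendsto (fun n => (d (x n) : Y)) atTop (𝓝 y) := hy
  have h2 : Tendsto (fun n => ((d (x n) : Y), (c • S.ι (d (x n)), x n))) atTop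
      (𝓝 (y, (c • S.ι y, x₀))) :=
    hy'.prodMk_nhds ((((S.ι.continuous.tendsto y).comp hy').const_smul c).prodMk_nhds hx)
  obtain ⟨h3, h4, h5⟩ := (mem_graph_opAR_iff _ _ _).1
    (hS.closed.mem_of_tendsto h2 (Eventually.of_forall h1))
  exact congrArg Subtype.val (huniq ⟨y, h3⟩ (d x₀) h4 (hd1 x₀) (by rw [h5, hd2]))

/-- The isomorphism `((w, v, y), x) ↦ ((w + D x, v, y), x)`, composed with reassociation. -/
def shearEquiv (D : dX →L[𝕜] Y) : ((Y × X) × dX × dX) ≃L[𝕜] ((Y × X × dX) × dX) where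
  toFun p := ((p.1.1 + D p.2.2, p.1.2, p.2.1), p.2.2)
  invFun q := ((q.1.1 - D q.2, q.1.2.1), (q.1.2.2, q.2))
  map_add' p q := by
    simp only [Prod.fst_add, Prod.snd_add, map_add, Prod.mk_add_mk]
    rw [add_add_add_comm]
  map_smul' a p := by simp
  left_inv p := by simp
  right_inv q := by simp
  continuous_toFun := by fun_prop
  continuous_invFun := by fun_prop

theorem shearEquiv_symm_apply (D : dX →L[𝕜] Y) (q : (Y × X × dX) × dX) :
    (shearEquiv D).symm q = ((q.1.1 - D q.2, q.1.2.1), (q.1.2.2, q.2)) := rfl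

variable (S) in
/-- The equation for the boundary component `x = R u` in the sheared variables. -/
def shearedFeedback (D : dX →L[𝕜] Y) : ((Y × X) × dX × dX) →L[𝕜] dX :=
  (S.B₁ + S.B₄.comp S.B₂).comp (ContinuousLinearMap.fst 𝕜 Y X ∘L ContinuousLinearMap.fst 𝕜 _ _ +
      D ∘L ContinuousLinearMap.snd 𝕜 dX dX ∘L ContinuousLinearMap.snd 𝕜 _ _) +
    S.B₃ ∘L ContinuousLinearMap.fst 𝕜 dX dX ∘L ContinuousLinearMap.snd 𝕜 _ _ +
    S.B₄ ∘L ContinuousLinearMap.snd 𝕜 dX dX ∘L ContinuousLinearMap.snd 𝕜 _ _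

variable (S) in
/-- The bounded part of the operator matrix in the sheared variables. -/
def shearedPerturbation (c : 𝕜) (D : dX →L[𝕜] Y) :
    ((Y × X) × dX × dX) →L[𝕜] ((Y × X) × dX × dX) :=
  ((-(D ∘L S.shearedFeedback D)).prod
    (c • S.ι ∘L D ∘L ContinuousLinearMap.snd 𝕜 dX dX ∘L ContinuousLinearMap.snd 𝕜 _ _)).prod
  ((ContinuousLinearMap.snd 𝕜 dX dX ∘L ContinuousLinearMap.snd 𝕜 _ _ +
    S.B₂ ∘L (ContinuousLinearMap.fst 𝕜 Y X ∘L ContinuousLinearMap.fst 𝕜 _ _ +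
      D ∘L ContinuousLinearMap.snd 𝕜 dX dX ∘L ContinuousLinearMap.snd 𝕜 _ _)).prod
    (S.shearedFeedback D))

theorem shearedFeedback_apply (D : dX →L[𝕜] Y) (w : Y) (v : X) (y x : dX) :
    S.shearedFeedback D ((w, v), (y, x)) =
      S.B₁ (w + D x) + S.B₄ (S.B₂ (w + D x)) + S.B₃ y + S.B₄ x := rfl

theorem shearedPerturbation_apply (c : 𝕜) (D : dX →L[𝕜] Y) (w : Y) (v : X) (y x : dX) :
    S.shearedPerturbation c D ((w, v), (y, x)) =
      ((-D (S.shearedFeedback D ((w, v), (y, x))), c • S.ι (D x)),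
        (x + S.B₂ (w + D x), S.shearedFeedback D ((w, v), (y, x)))) := rfl

/-- The operator matrix of the first order reformulation generates a group. -/
theorem Assumptions.generatesC0Group (hS : S.Assumptions) :
    GeneratesC0Group S.firstOrder.matrix := by
  obtain ⟨U, hU, hgen⟩ := hS.exists_phaseSpaceGroup
  obtain ⟨c, D, hD⟩ := hS.exists_dirichlet
  choose hDmem hDA hDR using hD
  -- The unperturbed generator is `(0 I; A₀ 0) ⊕ 0`. The term `-D x'` is part of the bounded
  -- perturbation because `x'` is the bounded feedback.
  obtain ⟨T, hT, hTgen⟩ := (hU.prodId (F := dX × dX)).exists_perturbation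
    (S.shearedPerturbation c D)
  refine ⟨_, hT.conj (shearEquiv D), ?_⟩
  rintro ⟨⟨u, v, y⟩, x⟩ ⟨⟨a, b, e⟩, d⟩
  simp only [ContinuousLinearMap.comp_apply, ContinuousLinearEquiv.coe_coe]
  rw [hasDerivAt_equiv_iff, hTgen, hasDerivAt_prodId_iff, hgen, mem_graph_matrix_iff]
  simp only [shearEquiv_symm_apply, shearedPerturbation_apply, shearedFeedback_apply,
    sub_add_cancel, Prod.mk_sub_mk, Prod.mk_eq_zero, sub_eq_zero]
  -- Hence `u - D x` lies in `ker R` exactly when `R u = x`.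
  have hR : ∀ hu : u ∈ S.A.domain, ∀ hw : u - D x ∈ S.A.domain,
      S.R ⟨u - D x, hw⟩ = S.R ⟨u, hu⟩ - x := fun hu hw =>
    (S.R.map_sub ⟨u, hu⟩ ⟨D x, hDmem x⟩).trans (by rw [hDR])
  have hA : ∀ hu : u ∈ S.A.domain, ∀ hw : u - D x ∈ S.A.domain,
      S.A ⟨u - D x, hw⟩ = S.A ⟨u, hu⟩ - c • S.ι (D x) := fun hu hw => by
    rw [← hDA x, ← LinearPMap.map_sub]
    rfl
  constructor
  · rintro ⟨hu, h1, h2, h3, h4, h5⟩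
    have hw : u - D x ∈ S.A.domain := Submodule.sub_mem _ hu (hDmem x)
    refine ⟨⟨?_, hw, ?_, ?_⟩, h4.symm, h5.symm⟩
    · rw [h5, ← h2]
      congr 1
      abel
    · rw [hR hu hw, h1, sub_self]
    · rw [hA hu hw, h3]
  · rintro ⟨⟨h1, hw, h2, h3⟩, h4, h5⟩
    have hu : u ∈ S.A.domain := by
      have := Submodule.add_mem _ hw (hDmem x)
      rwa [sub_add_cancel] at this
    refine ⟨hu, ?_, ?_, ?_, h4.symm, h5.symm⟩
    · rw [hR hu hw] at h2
      exact sub_eq_zero.1 h2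
    · rw [← h1, ← h5]
      congr 1
      abel
    · rw [hA hu hw] at h3
      exact sub_left_injective h3

end AcousticData

end AcousticBC

end

theorem proposition2p4 {𝕜 : Type*} [RCLike 𝕜] {Y X dX : Type*}
    [NormedAddCommGroup Y] [NormedSpace ℝ Y] [NormedSpace 𝕜 Y] [IsScalarTower ℝ 𝕜 Y]
    [CompleteSpace Y]
    [NormedAddCommGroup X] [NormedSpace ℝ X] [NormedSpace 𝕜 X] [IsScalarTower ℝ 𝕜 X]
    [CompleteSpace X]
    [NormedAddCommGroup dX] [NormedSpace ℝ dX] [NormedSpace 𝕜 dX] [IsScalarTower ℝ 𝕜 dX]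
    [CompleteSpace dX]
    (S : AcousticBC.AcousticData 𝕜 Y X dX) (hS : S.Assumptions) :
    S.firstOrder.WellPosed ∧ S.WellPosed₂ ∧
      AcousticBC.GeneratesC0Group S.firstOrder.matrix := by
  have hG := hS.generatesC0Group
  have hW := S.firstOrder.wellPosed_of_generatesC0Group hG
  exact ⟨hW, AcousticBC.AcousticData.wellPosed₂_of_firstOrder hW, hG⟩
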